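/- **Corollary (Flat $0/1$-simplices).** For $n\ge 0$ let $\rho_n$ be the maximal determinant of an $n\times n$ matrix with entries in $\{0,1\}$ (with $\rho_0=1$, the determinant of the empty matrix). For $n\ge 1$ let $\chi(n)$ be the maximal absolute value of an entry of $A^{-1}$, where $A$ ranges over the invertible $n\times n$ matrices with entries in $\{0,1\}$. For $d\ge 1$ let $\operatorname{flat}(d)$ be the minimal positive Euclidean distance of a point $v\in\{0,1\}^d$ from a hyperplane $H\subset\mathbb{R}^d$ that is the affine span of a set of points of $\{0,1\}^d$. Then there is a function $\varepsilon:\mathbb{N}\to\mathbb{R}$ with $\varepsilon(d)\to 0$ as $d\to\infty$ such that for all $d\ge 1$ \[ \frac{2^{d-1}}{\sqrt{d}^{\,d+1}}\ \le\ \frac{1}{\sqrt{d}\,\rho_{d-1}}\ \le\ \operatorname{flat}(d)\ \le\ \frac{1}{\chi(d)}\ \le\ \left(\frac1d\right)^{d/2}2^{d(2+\varepsilon(d))}. \] -/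

import Mathlib

open Filter Topology

noncomputable section

/-- The real `n × n` matrix `A` is a `0/1`-matrix. -/
def IsZeroOneMatrix {n : ℕ} (A : Matrix (Fin n) (Fin n) ℝ) : Prop :=
  ∀ i j, A i j = 0 ∨ A i j = 1

/-- The point `v` of Euclidean space `ℝ^d` is a `0/1`-vector. -/
def IsZeroOneVector {d : ℕ} (v : EuclideanSpace ℝ (Fin d)) : Prop :=
  ∀ i, v i = 0 ∨ v i = 1

/-- The determinants of `0/1`-matrices of size `n × n`. -/
def zeroOneDets (n : ℕ) : Set ℝ :=
  {r | ∃ A : Matrix (Fin n) (Fin n) ℝ, IsZeroOneMatrix A ∧ r = A.det}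

/-- `ρ_n`, the maximal determinant of a `0/1`-matrix of size `n × n`. -/
def rhoMax (n : ℕ) : ℝ := sSup (zeroOneDets n)

/-- The absolute values of the entries of inverses of invertible `0/1`-matrices of
size `n × n`. -/
def zeroOneInvEntries (n : ℕ) : Set ℝ :=
  {r | ∃ A : Matrix (Fin n) (Fin n) ℝ, IsZeroOneMatrix A ∧ A.det ≠ 0 ∧
    ∃ i j, r = |A⁻¹ i j|}

/-- `χ(n)`, the maximal absolute value of an entry in the inverse of an invertible
`0/1`-matrix of size `n × n`. -/
def chiMax (n : ℕ) : ℝ := sSup (zeroOneInvEntries n)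

/-- `H` is a hyperplane of `ℝ^d` (a nonempty affine subspace of dimension `d - 1`) that is
the affine span of a set of `0/1`-vectors. -/
def IsZeroOneHyperplane {d : ℕ} (H : AffineSubspace ℝ (EuclideanSpace ℝ (Fin d))) : Prop :=
  (H : Set (EuclideanSpace ℝ (Fin d))).Nonempty ∧
  Module.finrank ℝ H.direction + 1 = d ∧
  ∃ S : Set (EuclideanSpace ℝ (Fin d)), (∀ v ∈ S, IsZeroOneVector v) ∧ affineSpan ℝ S = H

/-- The positive Euclidean distances of `0/1`-vectors from hyperplanes spanned by
`0/1`-vectors in `ℝ^d`. -/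
def flatDistances (d : ℕ) : Set ℝ :=
  {r | 0 < r ∧ ∃ H : AffineSubspace ℝ (EuclideanSpace ℝ (Fin d)), IsZeroOneHyperplane H ∧
    ∃ v : EuclideanSpace ℝ (Fin d), IsZeroOneVector v ∧
      r = Metric.infDist v (H : Set (EuclideanSpace ℝ (Fin d)))}

/-- `flat(d)`, the minimal positive distance of a `0/1`-vector from a hyperplane spanned by
`0/1`-vectors in `ℝ^d`. -/
def flatMin (d : ℕ) : ℝ := sInf (flatDistances d)

/-! The following facts show that the maxima and the minimum above are attained. -/

theorem finite_zeroOneMatrix (n : ℕ) :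
    {A : Matrix (Fin n) (Fin n) ℝ | IsZeroOneMatrix A}.Finite := by
  have h : (Set.pi Set.univ fun _ : Fin n => Set.pi Set.univ fun _ : Fin n =>
      ({0, 1} : Set ℝ)).Finite :=
    Set.Finite.pi fun _ => Set.Finite.pi fun _ => Set.toFinite _
  exact h.subset fun A hA i _ j _ => hA i j

theorem finite_zeroOneVector (d : ℕ) :
    {v : EuclideanSpace ℝ (Fin d) | IsZeroOneVector v}.Finite := by
  have h : (Set.pi Set.univ fun _ : Fin d => ({0, 1} : Set ℝ)).Finite :=
    Set.Finite.pi fun _ => Set.toFinite _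
  refine (h.preimage (f := fun v : EuclideanSpace ℝ (Fin d) => (v : Fin d → ℝ))
    (fun a _ b _ hab => by ext i; exact congrFun hab i)).subset fun v hv => ?_
  exact fun i _ => hv i

theorem isGreatest_rhoMax (n : ℕ) : IsGreatest (zeroOneDets n) (rhoMax n) := by
  have hfin : (zeroOneDets n).Finite := by
    refine ((finite_zeroOneMatrix n).image Matrix.det).subset ?_
    rintro r ⟨A, hA, rfl⟩
    exact ⟨A, hA, rfl⟩
  have hne : (zeroOneDets n).Nonempty := ⟨_, fun _ _ => 0, fun _ _ => Or.inl rfl, rfl⟩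
  exact ⟨hne.csSup_mem hfin, fun r hr => le_csSup hfin.bddAbove hr⟩

theorem isGreatest_chiMax (n : ℕ) (hn : 1 ≤ n) :
    IsGreatest (zeroOneInvEntries n) (chiMax n) := by
  have hfin : (zeroOneInvEntries n).Finite := by
    refine (((finite_zeroOneMatrix n).prod (Set.toFinite
      (Set.univ : Set (Fin n × Fin n)))).image
      (fun p : Matrix (Fin n) (Fin n) ℝ × (Fin n × Fin n) => |p.1⁻¹ p.2.1 p.2.2|)).subset ?_
    rintro r ⟨A, hA, -, i, j, rfl⟩
    exact ⟨(A, (i, j)), ⟨hA, trivial⟩, rfl⟩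
  have hne : (zeroOneInvEntries n).Nonempty := by
    refine ⟨_, 1, fun i j => ?_, by simp, ⟨0, hn⟩, ⟨0, hn⟩, rfl⟩
    by_cases h : i = j
    · right; subst h; exact Matrix.one_apply_eq i
    · left; exact Matrix.one_apply_ne h
  exact ⟨hne.csSup_mem hfin, fun r hr => le_csSup hfin.bddAbove hr⟩

theorem nonempty_flatDistances (d : ℕ) (hd : 1 ≤ d) : (flatDistances d).Nonempty := by
  obtain ⟨n, rfl⟩ : ∃ n, d = n + 1 := ⟨d - 1, by omega⟩
  let p : Fin (n + 1) → EuclideanSpace ℝ (Fin (n + 1)) := fun i =>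
    if i = 0 then 0 else EuclideanSpace.single i (1 : ℝ)
  have hp : AffineIndependent ℝ p := by
    rw [affineIndependent_iff_linearIndependent_vsub ℝ p 0]
    have h1 : LinearIndependent ℝ (fun i : Fin (n + 1) => EuclideanSpace.single i (1 : ℝ)) :=
      (EuclideanSpace.orthonormal_single (𝕜 := ℝ) (ι := Fin (n + 1))).linearIndependent
    have h2 := h1.comp (Subtype.val : {x : Fin (n + 1) // x ≠ 0} → Fin (n + 1))
      Subtype.val_injective
    have h3 : (fun i : {x : Fin (n + 1) // x ≠ 0} => (p i -ᵥ p 0 :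
        EuclideanSpace ℝ (Fin (n + 1)))) =
        (fun i : Fin (n + 1) => EuclideanSpace.single i (1 : ℝ)) ∘ Subtype.val := by
      funext i
      simp [p, i.2]
    rw [h3]
    exact h2
  have hdim := hp.finrank_vectorSpan (n := n) (by simp)
  have hle : affineSpan ℝ (Set.range p) ≤
      (LinearMap.ker (EuclideanSpace.proj (𝕜 := ℝ) (0 : Fin (n + 1))).toLinearMap).toAffineSubspace := by
    rw [affineSpan_le]
    rintro _ ⟨i, rfl⟩
    by_cases h : i = 0
    · simp [p, h]
    · simp [p, h, Ne.symm h]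
  have hnot : EuclideanSpace.single (0 : Fin (n + 1)) (1 : ℝ) ∉ affineSpan ℝ (Set.range p) := by
    intro h
    have := hle h
    simp at this
  have hne : ((affineSpan ℝ (Set.range p) :
      AffineSubspace ℝ (EuclideanSpace ℝ (Fin (n + 1)))) :
      Set (EuclideanSpace ℝ (Fin (n + 1)))).Nonempty :=
    ⟨p 0, mem_affineSpan ℝ ⟨0, rfl⟩⟩
  refine ⟨_, ?_, affineSpan ℝ (Set.range p), ⟨hne, ?_, Set.range p, ?_, rfl⟩,
    EuclideanSpace.single (0 : Fin (n + 1)) (1 : ℝ), ?_, rfl⟩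
  · refine ((AffineSubspace.closed_of_finiteDimensional _).notMem_iff_infDist_pos hne).1 hnot
  · rw [direction_affineSpan, hdim]
  · rintro _ ⟨i, rfl⟩ j
    by_cases h : i = 0
    · left; simp [p, h]
    · by_cases hj : j = i
      · right; simp [p, h, hj]
      · left; simp [p, h, hj]
  · intro j
    by_cases hj : j = 0
    · right; simp [hj]
    · left; simp [hj]

theorem isLeast_flatMin (d : ℕ) (hd : 1 ≤ d) : IsLeast (flatDistances d) (flatMin d) := by
  have hfin : (flatDistances d).Finite := by
    refine (((finite_zeroOneVector d).finite_subsets.prod (finite_zeroOneVector d)).image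
      (fun q : Set (EuclideanSpace ℝ (Fin d)) × EuclideanSpace ℝ (Fin d) =>
        Metric.infDist q.2 (affineSpan ℝ q.1 : Set (EuclideanSpace ℝ (Fin d))))).subset ?_
    rintro r ⟨-, H, ⟨-, -, S, hS, rfl⟩, v, hv, rfl⟩
    exact ⟨(S, v), ⟨hS, hv⟩, rfl⟩
  exact ⟨(nonempty_flatDistances d hd).csInf_mem hfin, fun r hr => csInf_le hfin.bddBelow hr⟩

end

/-! The first inequality is Hadamard's bound for a bordered `±1`-matrix. The two middle ones rest on
normal vectors. Reflecting the cube moves a vertex of the hyperplane to the origin; a normal is then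
given by minors of order `d - 1` of a `0/1`-matrix, each at most `ρ_{d-1}`, and its inner product
with the vector to `v` is a nonzero integer determinant (`le_flatMin`). Conversely, a column of
`A⁻¹` is normal to the hyperplane through `0` and all but one of the rows of `A`, and the remaining
row lies at distance one over the length of that column (`flatMin_le`).

The last inequality asks for ill-conditioned matrices: `log₂ χ(d) ≥ (d/2) log₂ d - 2d - o(d)`. Since
`χ(a) χ(b) ≤ χ(a + b)`, splitting off leading binary digits reduces this to `d = 2 ^ m`. There one
takes `A = T Q`, with `Q` the Walsh matrix and `T` lower triangular. Row `2 ^ s + l` of `T` (`l ≥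
2`) averages over a flat over `𝔽₂` with `2 ^ w(l)` points, `w` being the binary weight; Walsh
functions are balanced or constant on such a flat, so `A` again has entries `±1`
(`triangularRow_walsh_eq`). The diagonal entry is `2 ^ (-w(l))`, so in the solution of `T x = e₁`
each step multiplies by almost `2 ^ w(l)`, with a loss of at most `16 · 2 ^ (-w(l))` in the exponent
(`rpow_mul_le_apply`). The weights add up to the main term `m 2 ^ m / 2 - 2 ^ m`, the losses to
`O((3/2) ^ m)`. As `x` is the Walsh transform of a column of `A⁻¹`, that column has a large entry,
and an inverse of a `0/1`-matrix inherits it (`two_mul_abs_le_chiMax`). -/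

/-! ### Determinants of `0/1`-matrices -/

/-- **Hadamard's inequality** for the rows of a real matrix. -/
theorem abs_det_le_prod_norm_row {n : ℕ} (A : Matrix (Fin n) (Fin n) ℝ) :
    |A.det| ≤ ∏ i, ‖(WithLp.toLp 2 (A i) : EuclideanSpace ℝ (Fin n))‖ := by
  have : Fact (Module.finrank ℝ (EuclideanSpace ℝ (Fin n)) = n) := ⟨by simp⟩
  let b := EuclideanSpace.basisFun (Fin n) ℝ
  let o := b.toBasis.orientation
  have h := o.abs_volumeForm_apply_le (fun i => (WithLp.toLp 2 (A i) : EuclideanSpace ℝ (Fin n)))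
  rw [o.volumeForm_robust' b, Module.Basis.det_apply] at h
  convert h using 2
  rw [← Matrix.det_transpose]
  congr 1

theorem abs_det_le_of_abs_entry_eq_one {n : ℕ} (A : Matrix (Fin n) (Fin n) ℝ)
    (hA : ∀ i j, |A i j| = 1) : |A.det| ≤ Real.sqrt n ^ n := by
  refine (abs_det_le_prod_norm_row A).trans (le_of_eq ?_)
  have : ∀ i, ‖(WithLp.toLp 2 (A i) : EuclideanSpace ℝ (Fin n))‖ = Real.sqrt n := by
    intro i
    rw [EuclideanSpace.norm_eq]
    simp [hA]
  simp [this]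

/-- Bordering `1 - 2B` by a row and a column of ones gives a `±1`-matrix of order `n + 1` whose
Schur complement is `-2B`. -/
theorem two_pow_mul_abs_det_le {n : ℕ} {B : Matrix (Fin n) (Fin n) ℝ} (hB : IsZeroOneMatrix B) :
    2 ^ n * |B.det| ≤ Real.sqrt (n + 1 : ℕ) ^ (n + 1) := by
  let A : Matrix (Fin 1 ⊕ Fin n) (Fin 1 ⊕ Fin n) ℝ :=
    Matrix.fromBlocks 1 (Matrix.of fun _ _ => 1) (Matrix.of fun _ _ => 1)
      (Matrix.of fun i j => 1 - 2 * B i j)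
  have hdet : A.det = (-2) ^ n * B.det := by
    rw [Matrix.det_fromBlocks_one₁₁]
    have : (Matrix.of fun i j => 1 - 2 * B i j) -
        (Matrix.of fun (_ : Fin n) (_ : Fin 1) => (1 : ℝ)) *
          (Matrix.of fun (_ : Fin 1) (_ : Fin n) => (1 : ℝ)) =
        (-2 : ℝ) • B := by
      ext i j
      simp [Matrix.mul_apply]
    rw [this, Matrix.det_smul, Fintype.card_fin]
  let e : Fin (n + 1) ≃ Fin 1 ⊕ Fin n := (finSumFinEquiv.trans (finCongr (add_comm 1 n))).symm
  have h := abs_det_le_of_abs_entry_eq_one (A.submatrix e e) (fun i j => by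
    have hA : ∀ a b, |A a b| = 1 := by
      rintro (a | a) (b | b)
      · simp [A, Subsingleton.elim a b]
      · simp [A]
      · simp [A]
      · rcases hB a b with h | h <;> simp [A, h]
        norm_num
    exact hA _ _)
  rw [Matrix.det_submatrix_equiv_self, hdet, abs_mul, abs_pow] at h
  simpa using h

theorem rhoMax_le (n : ℕ) : 2 ^ n * rhoMax n ≤ Real.sqrt (n + 1 : ℕ) ^ (n + 1) := by
  obtain ⟨A, hA, h⟩ := (isGreatest_rhoMax n).1
  rw [h]
  exact (mul_le_mul_of_nonneg_left (le_abs_self _) (by positivity)).trans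
    (two_pow_mul_abs_det_le hA)

theorem isZeroOneMatrix_one (n : ℕ) : IsZeroOneMatrix (1 : Matrix (Fin n) (Fin n) ℝ) := by
  intro i j
  by_cases h : i = j
  · right; subst h; exact Matrix.one_apply_eq i
  · left; exact Matrix.one_apply_ne h

theorem one_le_rhoMax (n : ℕ) : 1 ≤ rhoMax n := by
  refine (isGreatest_rhoMax n).2 ⟨1, isZeroOneMatrix_one n, by simp⟩

theorem IsZeroOneMatrix.abs_det_le_rhoMax {n : ℕ} {A : Matrix (Fin n) (Fin n) ℝ}
    (hA : IsZeroOneMatrix A) : |A.det| ≤ rhoMax n := by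
  have h1 : A.det ≤ rhoMax n := (isGreatest_rhoMax n).2 ⟨A, hA, rfl⟩
  refine abs_le'.2 ⟨h1, ?_⟩
  match n, A, hA with
  | 0, A, _ => simp only [Matrix.det_isEmpty]; linarith [one_le_rhoMax 0]
  | 1, A, hA =>
    have := one_le_rhoMax 1
    rw [Matrix.det_fin_one]
    rcases hA 0 0 with h | h <;> rw [h] <;> linarith
  | n + 2, A, hA =>
    refine (isGreatest_rhoMax (n + 2)).2
      ⟨A.submatrix (Equiv.swap 0 1) id, fun i j => hA _ _, ?_⟩
    rw [Matrix.det_permute]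
    simp

theorem IsZeroOneMatrix.exists_int_det {n : ℕ} {A : Matrix (Fin n) (Fin n) ℝ}
    (hA : IsZeroOneMatrix A) : ∃ z : ℤ, A.det = z := by
  choose B hB using fun i j => show ∃ z : ℤ, A i j = z by
    rcases hA i j with h | h
    · exact ⟨0, by simp [h]⟩
    · exact ⟨1, by simp [h]⟩
  refine ⟨(Matrix.of B).det, ?_⟩
  rw [Int.cast_det]
  congr 1
  ext i j
  simp [hB]

theorem IsZeroOneMatrix.one_le_abs_det {n : ℕ} {A : Matrix (Fin n) (Fin n) ℝ}
    (hA : IsZeroOneMatrix A) (h0 : A.det ≠ 0) : 1 ≤ |A.det| := by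
  obtain ⟨z, hz⟩ := hA.exists_int_det
  rw [hz] at h0 ⊢
  exact_mod_cast Int.one_le_abs (by exact_mod_cast h0)

theorem rhoMax_bound_le (d : ℕ) (hd : 1 ≤ d) :
    (2 : ℝ) ^ (d - 1) / Real.sqrt d ^ (d + 1) ≤ 1 / (Real.sqrt d * rhoMax (d - 1)) := by
  obtain ⟨n, rfl⟩ : ∃ n, d = n + 1 := ⟨d - 1, by omega⟩
  have hs : 0 < Real.sqrt (n + 1 : ℕ) := Real.sqrt_pos.2 (by positivity)
  have hr := one_le_rhoMax n
  have h := rhoMax_le n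
  rw [Nat.add_sub_cancel, div_le_div_iff₀ (by positivity) (by positivity), one_mul,
    pow_succ _ (n + 1)]
  nlinarith

/-! ### Distances from hyperplanes spanned by `0/1`-vectors -/

open scoped Matrix in
theorem le_flatMin (d : ℕ) (hd : 1 ≤ d) : 1 / (Real.sqrt d * rhoMax (d - 1)) ≤ flatMin d := by
  obtain ⟨hpos, H, ⟨hne, hfin, S, hS, rfl⟩, v, hv, hr⟩ := (isLeast_flatMin d hd).1
  obtain ⟨n, rfl⟩ : ∃ n, d = n + 1 := ⟨d - 1, by omega⟩
  rw [Nat.add_sub_cancel, hr]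
  have hvH : v ∉ affineSpan ℝ S := by
    intro h
    rw [hr, Metric.infDist_zero_of_mem h] at hpos
    exact lt_irrefl _ hpos
  obtain ⟨p, hp⟩ : S.Nonempty := (affineSpan_nonempty ℝ).1 hne
  have hpH : p ∈ affineSpan ℝ S := mem_affineSpan ℝ hp
  rw [direction_affineSpan] at hfin
  have hdir := vectorSpan_eq_span_vsub_set_right ℝ hp
  obtain ⟨b, hbS, hbspan, hbli⟩ := exists_linearIndependent ℝ ((· -ᵥ p) '' S)
  rw [← hdir] at hbspan
  have hbfin : b.Finite := hbli.setFinite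
  have := hbfin.fintype
  have hcard : Fintype.card b = n := by
    have h := finrank_span_set_eq_card hbli
    rw [hbspan, Set.toFinset_card] at h
    omega
  let e : Fin n ≃ b := (Fintype.equivFinOfCardEq hcard).symm
  let u : Fin (n + 1) → EuclideanSpace ℝ (Fin (n + 1)) := Fin.cons (v - p) (fun i => (e i : _))
  have hspan : Submodule.span ℝ (Set.range fun i : Fin n => (e i : EuclideanSpace ℝ (Fin (n + 1)))) =
      vectorSpan ℝ S := by
    rw [← hbspan]
    congr 1
    ext x
    simp only [Set.mem_range]
    exact ⟨fun ⟨i, hi⟩ => hi ▸ (e i).2, fun hx => ⟨e.symm ⟨x, hx⟩, by simp⟩⟩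
  have huli : LinearIndependent ℝ u := by
    rw [linearIndependent_finCons]
    refine ⟨hbli.comp e e.injective, ?_⟩
    rw [hspan, ← direction_affineSpan]
    intro h
    apply hvH
    have := AffineSubspace.vadd_mem_of_mem_direction h hpH
    simpa using this
  let M : Matrix (Fin (n + 1)) (Fin (n + 1)) ℝ := Matrix.of fun i j => u i j
  have hMdet : M.det ≠ 0 := by
    have h : LinearIndependent ℝ M.row := by
      have := huli.map' (WithLp.linearEquiv 2 ℝ (Fin (n + 1) → ℝ)).toLinearMap
        (LinearEquiv.ker _)
      exact this
    rw [Matrix.linearIndependent_rows_iff_isUnit, Matrix.isUnit_iff_isUnit_det] at h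
    exact h.ne_zero
  -- Multiplying by these signs is the linear part of the reflection of the cube that takes `p` to
  -- the origin, so differences from `p` become `0/1`-vectors.
  let s : Fin (n + 1) → ℝ := fun j => 1 - 2 * p j
  have hs : ∀ j, |s j| = 1 := by
    intro j
    rcases hS p hp j with h | h <;> simp [s, h]
    norm_num
  let N : Matrix (Fin (n + 1)) (Fin (n + 1)) ℝ := M * Matrix.diagonal s
  have hNapp : ∀ i j, N i j = u i j * s j := fun i j => by simp [N, M]
  have hNdet : N.det ≠ 0 := by
    rw [Matrix.det_mul, Matrix.det_diagonal]
    refine mul_ne_zero hMdet (Finset.prod_ne_zero_iff.2 fun j _ h => ?_)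
    have := hs j
    rw [h] at this
    simp at this
  have key : ∀ a : EuclideanSpace ℝ (Fin (n + 1)), IsZeroOneVector a → ∀ j,
      (a - p) j * s j = 0 ∨ (a - p) j * s j = 1 := by
    intro a ha j
    rcases ha j with h1 | h1 <;> rcases hS p hp j with h2 | h2 <;> simp [s, h1, h2]
    norm_num
  have hN : IsZeroOneMatrix N := by
    intro i j
    rw [hNapp]
    refine Fin.cases ?_ (fun i => ?_) i
    · exact key v hv j
    · obtain ⟨a, ha, hab⟩ := hbS (e i).2
      have := key a (hS a ha) j
      simp only [vsub_eq_sub] at hab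
      rw [hab] at this
      exact this
  -- The cofactors of row `0`, with the reflection undone: orthogonal to every `u i` except `u 0`,
  -- where the inner product is `N.det`.
  let w : EuclideanSpace ℝ (Fin (n + 1)) := WithLp.toLp 2 fun j => s j * N.adjugate j 0
  have hinner : ∀ i, inner ℝ w (u i) = if i = 0 then N.det else 0 := by
    intro i
    have h := congrFun (congrFun (Matrix.mul_adjugate N) i) 0
    rw [Matrix.mul_apply] at h
    simp only [hNapp, Matrix.smul_apply, Matrix.one_apply, smul_eq_mul, mul_ite, mul_one,
      mul_zero] at h
    rw [← h, PiLp.inner_apply]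
    refine Finset.sum_congr rfl fun j _ => ?_
    simp [w]
    ring
  have hw0 : ∀ y ∈ vectorSpan ℝ S, inner ℝ w y = 0 := by
    intro y hy
    rw [← hspan] at hy
    induction hy using Submodule.span_induction with
    | mem x hx =>
      obtain ⟨i, rfl⟩ := hx
      simpa [u] using hinner i.succ
    | zero => simp
    | add x y _ _ hx hy => rw [inner_add_right, hx, hy, add_zero]
    | smul a x _ hx => rw [inner_smul_right, hx, mul_zero]
  have hρ := one_le_rhoMax n
  have hwnorm : ‖w‖ ≤ Real.sqrt (n + 1 : ℕ) * rhoMax n := by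
    rw [EuclideanSpace.norm_eq, ← Real.sqrt_sq (zero_le_one.trans hρ), ← Real.sqrt_mul (by positivity)]
    refine Real.sqrt_le_sqrt ?_
    have : ∀ j ∈ (Finset.univ : Finset (Fin (n + 1))), ‖w j‖ ^ 2 ≤ rhoMax n ^ 2 := by
      intro j _
      refine pow_le_pow_left₀ (norm_nonneg _) ?_ 2
      simp only [w, Real.norm_eq_abs, abs_mul, hs, one_mul]
      rw [Matrix.adjugate_fin_succ_eq_det_submatrix, abs_mul, abs_pow, abs_neg, abs_one, one_pow,
        one_mul]
      exact IsZeroOneMatrix.abs_det_le_rhoMax fun a b => hN _ _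
    simpa using Finset.sum_le_card_nsmul _ _ _ this
  refine (Metric.le_infDist hne).2 fun {y} hy => ?_
  have hyp : y - p ∈ vectorSpan ℝ S := by
    rw [← direction_affineSpan]
    exact AffineSubspace.vsub_mem_direction hy hpH
  have h1 : inner ℝ w (v - y) = N.det := by
    have h2 := hinner 0
    have h3 := hw0 _ hyp
    simp only [u, Fin.cons_zero, if_true] at h2
    rw [← h2, show v - y = (v - p) - (y - p) by abel, inner_sub_right, h3, sub_zero]
  have h2 := abs_real_inner_le_norm w (v - y)
  rw [h1] at h2
  have h3 := hN.one_le_abs_det hNdet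
  have hsq : 0 < Real.sqrt (n + 1 : ℕ) := Real.sqrt_pos.2 (by positivity)
  rw [div_le_iff₀ (by positivity), dist_eq_norm]
  nlinarith [norm_nonneg (v - y)]

theorem one_le_chiMax {n : ℕ} (hn : 1 ≤ n) : 1 ≤ chiMax n :=
  (isGreatest_chiMax n hn).2
    ⟨1, isZeroOneMatrix_one n, by simp, ⟨0, hn⟩, ⟨0, hn⟩, by simp⟩

open scoped Matrix in
theorem flatMin_le (d : ℕ) (hd : 1 ≤ d) : flatMin d ≤ 1 / chiMax d := by
  obtain ⟨A, hA, hdet, i₀, j₀, hχ⟩ := (isGreatest_chiMax d hd).1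
  have hunit : IsUnit A.det := isUnit_iff_ne_zero.2 hdet
  let w : EuclideanSpace ℝ (Fin d) := WithLp.toLp 2 fun i => A⁻¹ i j₀
  let a : Fin d → EuclideanSpace ℝ (Fin d) := fun l => WithLp.toLp 2 (A l)
  have hinner : ∀ l, inner ℝ w (a l) = if l = j₀ then 1 else 0 := by
    intro l
    have h := congrFun (congrFun (Matrix.mul_nonsing_inv A hunit) l) j₀
    rw [Matrix.mul_apply, Matrix.one_apply] at h
    rw [← h, PiLp.inner_apply]
    refine Finset.sum_congr rfl fun j _ => ?_
    simp [w, a]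
  have hali : LinearIndependent ℝ a := by
    have h := Matrix.linearIndependent_rows_of_det_ne_zero hdet
    exact h.map' (WithLp.linearEquiv 2 ℝ (Fin d → ℝ)).symm.toLinearMap (LinearEquiv.ker _)
  let T : Set (EuclideanSpace ℝ (Fin d)) := a '' {l | l ≠ j₀}
  let K : Submodule ℝ (EuclideanSpace ℝ (Fin d)) := Submodule.span ℝ T
  have hKfin : Module.finrank ℝ K + 1 = d := by
    have h := finrank_span_eq_card (hali.comp (Subtype.val : {l // l ≠ j₀} → Fin d)
      Subtype.val_injective)
    have hT : Set.range (a ∘ (Subtype.val : {l // l ≠ j₀} → Fin d)) = T := by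
      rw [Set.range_comp, Subtype.range_coe_subtype]
    rw [hT] at h
    rw [show Module.finrank ℝ K = _ from h, Fintype.card_subtype_compl]
    simp
    omega
  have hKw : K = (ℝ ∙ w)ᗮ := by
    have hw : w ≠ 0 := by
      intro h
      have := hinner j₀
      simp [h] at this
    have hle : K ≤ (ℝ ∙ w)ᗮ := by
      rw [Submodule.span_le]
      rintro _ ⟨l, hl, rfl⟩
      rw [SetLike.mem_coe, Submodule.mem_orthogonal_singleton_iff_inner_right, hinner]
      simpa using hl
    refine Submodule.eq_of_le_of_finrank_eq hle ?_
    have h1 := Submodule.finrank_add_finrank_orthogonal (ℝ ∙ w)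
    rw [finrank_span_singleton hw, finrank_euclideanSpace_fin] at h1
    omega
  have hspan : affineSpan ℝ (insert 0 T) = K.toAffineSubspace := by
    apply SetLike.coe_injective
    rw [affineSpan_insert_zero]
    rfl
  have hH : IsZeroOneHyperplane (affineSpan ℝ (insert 0 T)) := by
    refine ⟨⟨0, mem_affineSpan ℝ (by simp)⟩, ?_, insert 0 T, ?_, rfl⟩
    · rw [hspan, Submodule.toAffineSubspace_direction]
      exact hKfin
    · rintro _ (rfl | ⟨l, -, rfl⟩) i
      · left; simp
      · exact hA l i
  have hne : ((affineSpan ℝ (insert 0 T) : AffineSubspace ℝ (EuclideanSpace ℝ (Fin d))) :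
    Set (EuclideanSpace ℝ (Fin d))).Nonempty := hH.1
  have hnot : a j₀ ∉ affineSpan ℝ (insert 0 T) := by
    rw [hspan, Submodule.mem_toAffineSubspace, hKw,
      Submodule.mem_orthogonal_singleton_iff_inner_right, hinner]
    simp
  have hmem : Metric.infDist (a j₀) (affineSpan ℝ (insert 0 T) :
      AffineSubspace ℝ (EuclideanSpace ℝ (Fin d))) ∈ flatDistances d :=
    ⟨((AffineSubspace.closed_of_finiteDimensional _).notMem_iff_infDist_pos hne).1 hnot,
      _, hH, a j₀, hA j₀, rfl⟩
  have hχpos : 0 < chiMax d := one_pos.trans_le (one_le_chiMax hd)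
  have hwχ : chiMax d ≤ ‖w‖ := by
    rw [hχ]
    exact PiLp.norm_apply_le w i₀
  have hwpos := hχpos.trans_le hwχ
  refine ((isLeast_flatMin d hd).2 hmem).trans ?_
  -- The foot of the perpendicular from `a j₀`, because `w` is normal to the hyperplane and has
  -- inner product `1` with `a j₀`.
  let y : EuclideanSpace ℝ (Fin d) := a j₀ - (1 / ‖w‖ ^ 2) • w
  have hy : y ∈ affineSpan ℝ (insert 0 T) := by
    rw [hspan, Submodule.mem_toAffineSubspace, hKw,
      Submodule.mem_orthogonal_singleton_iff_inner_right, inner_sub_right, hinner,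
      inner_smul_right, real_inner_self_eq_norm_sq]
    simp [hwpos.ne']
  refine (Metric.infDist_le_dist_of_mem hy).trans ?_
  have : dist (a j₀) y = 1 / ‖w‖ := by
    rw [dist_eq_norm]
    simp only [y, sub_sub_cancel, norm_smul, Real.norm_eq_abs]
    rw [abs_of_pos (by positivity)]
    field_simp
  rw [this]
  exact one_div_le_one_div_of_le hχpos hwχ

/-! ### Reduction to powers of two -/

/-- The maximal entry of an inverse is supermultiplicative in the size of the matrix. -/
theorem chiMax_mul_le {a b : ℕ} (ha : 1 ≤ a) (hb : 1 ≤ b) :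
    chiMax a * chiMax b ≤ chiMax (a + b) := by
  obtain ⟨A, hA, hA0, i, j, hAij⟩ := (isGreatest_chiMax a ha).1
  obtain ⟨B, hB, hB0, k, l, hBkl⟩ := (isGreatest_chiMax b hb).1
  -- A single one, placed so that an entry of `B⁻¹ * C * A⁻¹` is the product of the two extremal
  -- entries.
  let C : Matrix (Fin b) (Fin a) ℝ := Matrix.single l i 1
  let M : Matrix (Fin a ⊕ Fin b) (Fin a ⊕ Fin b) ℝ := Matrix.fromBlocks A 0 C B
  have hM : ∀ p q, M p q = 0 ∨ M p q = 1 := by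
    rintro (p | p) (q | q)
    · exact hA p q
    · left; simp [M]
    · by_cases h : l = p ∧ i = q
      · right; simp [M, C, h]
      · left; simp [M, C, h]
    · exact hB p q
  have hinv : M⁻¹ = Matrix.fromBlocks A⁻¹ 0 (-(B⁻¹ * C * A⁻¹)) B⁻¹ := by
    apply Matrix.inv_fromBlocks_zero₁₂_of_isUnit_iff
    simp [Matrix.isUnit_iff_isUnit_det, hA0, hB0]
  have hentry : M⁻¹ (Sum.inr k) (Sum.inl j) = -(B⁻¹ k l * A⁻¹ i j) := by
    rw [hinv, Matrix.fromBlocks_apply₂₁, Matrix.neg_apply, Matrix.mul_apply,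
      Finset.sum_eq_single i, Matrix.mul_apply, Finset.sum_eq_single l]
    · simp [C]
    · intro q _ hq
      simp [C, hq.symm]
    · simp
    · intro q _ hq
      rw [Matrix.mul_apply]
      simp [C, hq.symm]
    · simp
  let e : Fin (a + b) ≃ Fin a ⊕ Fin b := finSumFinEquiv.symm
  refine (isGreatest_chiMax (a + b) (by omega)).2
    ⟨M.submatrix e e, fun p q => hM _ _, ?_, e.symm (Sum.inr k), e.symm (Sum.inl j), ?_⟩
  · rw [Matrix.det_submatrix_equiv_self, Matrix.det_fromBlocks_zero₁₂]
    exact mul_ne_zero hA0 hB0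
  · rw [Matrix.inv_submatrix_equiv, Matrix.submatrix_apply, e.apply_symm_apply,
      e.apply_symm_apply, hentry, abs_neg, abs_mul, hAij, hBkl, mul_comm]

/-- The left side is `log₂ (1 + t) + t log₂ (1 + 1/t)`, and both summands are at most `1`, the
second by Bernoulli with exponent `1/t ≥ 1`. -/
theorem add_one_mul_logb_le {t : ℝ} (ht0 : 0 < t) (ht1 : t ≤ 1) :
    (1 + t) * Real.logb 2 (1 + t) - t * Real.logb 2 t ≤ 2 := by
  have h1 : Real.logb 2 (1 + t) ≤ 1 := by
    rw [Real.logb_le_iff_le_rpow one_lt_two (by positivity)]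
    norm_num
    linarith
  have h2 : Real.logb 2 (1 + 1 / t) ≤ 1 / t := by
    rw [Real.logb_le_iff_le_rpow one_lt_two (by positivity)]
    have := one_add_mul_self_le_rpow_one_add (s := 1) (by norm_num) (p := 1 / t)
      (by rw [le_div_iff₀ ht0]; linarith)
    norm_num at this ⊢
    linarith
  have h3 : Real.logb 2 (1 + t) = Real.logb 2 t + Real.logb 2 (1 + 1 / t) := by
    rw [← Real.logb_mul (by positivity) (by positivity)]
    congr 1
    field_simp
    ring
  have h4 : t * Real.logb 2 (1 + 1 / t) ≤ 1 := by
    calc t * Real.logb 2 (1 + 1 / t) ≤ t * (1 / t) := by gcongr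
      _ = 1 := by field_simp
  calc _ = Real.logb 2 (1 + t) + t * Real.logb 2 (1 + 1 / t) := by rw [h3]; ring
    _ ≤ 2 := by linarith

/-- Adding to `2 ^ m` a smaller number `r` raises `n log₂ n - 2 n` by no more than the
sum of the contributions of the two parts. -/
theorem mul_logb_two_pow_add_le (m : ℕ) {r : ℝ} (hr : 0 < r) (hr' : r ≤ 2 ^ m) :
    (2 ^ m + r) * Real.logb 2 (2 ^ m + r) - 2 * (2 ^ m + r) ≤
      m * 2 ^ m + (r * Real.logb 2 r - 2 * r) := by
  have hN : (0 : ℝ) < 2 ^ m := by positivity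
  set t := r / 2 ^ m with ht
  have hrt : r = t * 2 ^ m := by rw [ht]; field_simp
  have ht0 : 0 < t := by positivity
  have h := add_one_mul_logb_le ht0 ((div_le_one hN).2 hr')
  have hl : Real.logb 2 ((2 : ℝ) ^ m) = m := by
    rw [Real.logb_pow]; simp
  have e1 : Real.logb 2 (2 ^ m + r) = m + Real.logb 2 (1 + t) := by
    rw [hrt, ← hl, ← Real.logb_mul (by positivity) (by positivity)]
    congr 1
    ring
  have e2 : Real.logb 2 r = m + Real.logb 2 t := by
    rw [hrt, Real.logb_mul (by positivity) (by positivity), hl]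
    ring
  rw [e1, e2, hrt]
  nlinarith [mul_le_mul_of_nonneg_right h hN.le]

/-- If the powers of two satisfy a lower bound for `log₂ χ`, then all numbers satisfy one. -/
theorem logb_chiMax_ge_of_two_pow
    (H : ∀ m : ℕ, m * 2 ^ m / 2 - 2 ^ m - 40 * (3 / 2 : ℝ) ^ m ≤ Real.logb 2 (chiMax (2 ^ m)))
    (m : ℕ) : ∀ n : ℕ, 1 ≤ n → n < 2 ^ m →
      (n : ℝ) / 2 * Real.logb 2 n - 2 * n - 80 * (3 / 2 : ℝ) ^ m ≤ Real.logb 2 (chiMax n) := by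
  induction m with
  | zero => intro n h1 h2; omega
  | succ m ih =>
    intro n h1 h2
    have h32 : (0 : ℝ) < (3 / 2) ^ m := by positivity
    rcases lt_or_ge n (2 ^ m) with hlt | hge
    · refine le_trans ?_ (ih n h1 hlt)
      rw [pow_succ]
      linarith
    · obtain ⟨r, rfl⟩ := Nat.exists_eq_add_of_le hge
      have hm := H m
      rcases Nat.eq_zero_or_pos r with rfl | hr
      · refine le_trans ?_ hm
        have : Real.logb 2 ((2 : ℝ) ^ m) = m := by
          rw [Real.logb_pow]; simp
        push_cast
        rw [add_zero, this, pow_succ _ m]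
        nlinarith [show (0 : ℝ) < 2 ^ m by positivity]
      · have hr' : r < 2 ^ m := by rw [pow_succ] at h2; omega
        have h3 := ih r hr hr'
        have h4 := mul_logb_two_pow_add_le m (r := r) (by exact_mod_cast hr)
          (by exact_mod_cast hr'.le)
        have hp : (1 : ℕ) ≤ 2 ^ m := Nat.one_le_two_pow
        have c1 := one_le_chiMax hp
        have c2 := one_le_chiMax (n := r) hr
        have h5 : Real.logb 2 (chiMax (2 ^ m)) + Real.logb 2 (chiMax r) ≤
            Real.logb 2 (chiMax (2 ^ m + r)) := by
          rw [← Real.logb_mul (by positivity) (by positivity)]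
          exact Real.logb_le_logb_of_le one_lt_two (by positivity) (chiMax_mul_le hp hr)
        -- The error terms reproduce themselves: `(40 + 80) (3/2) ^ m = 80 (3/2) ^ (m + 1)`.
        refine le_trans ?_ h5
        push_cast
        rw [pow_succ _ m]
        linarith

theorem tendsto_const_mul_pow_log (c : ℝ) :
    Tendsto (fun d : ℕ => c * (3 / 4 : ℝ) ^ (Nat.log 2 d)) atTop (𝓝 0) := by
  have h1 : Tendsto (fun m : ℕ => (3 / 4 : ℝ) ^ m) atTop (𝓝 0) :=
    tendsto_pow_atTop_nhds_zero_of_lt_one (by norm_num) (by norm_num)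
  have h2 : Tendsto (fun d : ℕ => Nat.log 2 d) atTop atTop :=
    tendsto_atTop.2 fun b => (eventually_ge_atTop (2 ^ b)).mono fun d hd =>
      Nat.le_log_of_pow_le one_lt_two hd
  simpa using (h1.comp h2).const_mul c

theorem one_div_chiMax_le
    (H : ∀ m : ℕ, m * 2 ^ m / 2 - 2 ^ m - 40 * (3 / 2 : ℝ) ^ m ≤ Real.logb 2 (chiMax (2 ^ m)))
    (d : ℕ) (hd : 1 ≤ d) :
    1 / chiMax d ≤ (1 / (d : ℝ)) ^ ((d : ℝ) / 2) *
      (2 : ℝ) ^ ((d : ℝ) * (2 + 120 * (3 / 4 : ℝ) ^ (Nat.log 2 d))) := by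
  have h := logb_chiMax_ge_of_two_pow H (Nat.log 2 d + 1) d hd
    (Nat.lt_pow_succ_log_self one_lt_two d)
  have hd' : (0 : ℝ) < d := by exact_mod_cast hd
  have hχ : 0 < chiMax d := zero_lt_one.trans_le (one_le_chiMax hd)
  have h2 : (2 : ℝ) ^ Nat.log 2 d ≤ d := by
    exact_mod_cast Nat.pow_log_le_self 2 (by omega)
  -- This turns the error `80 (3/2) ^ (log + 1) = 120 (3/2) ^ log` into `d` times a null sequence.
  have h3 : (3 / 2 : ℝ) ^ Nat.log 2 d ≤ d * (3 / 4 : ℝ) ^ Nat.log 2 d := by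
    rw [show (3 / 2 : ℝ) = 2 * (3 / 4) by norm_num, mul_pow]
    gcongr
  rw [← Real.logb_le_logb one_lt_two (by positivity) (by positivity),
    Real.logb_mul (by positivity) (by positivity), Real.logb_rpow_eq_mul_logb_of_pos (by positivity),
    Real.logb_rpow (by norm_num) (by norm_num), one_div, one_div, Real.logb_inv, Real.logb_inv]
  rw [pow_succ] at h
  linarith

/-! ### Binary weights -/

/-- Induction on the leading binary digit of a positive number. -/
theorem two_pow_add_induction {P : ∀ n : ℕ, 1 ≤ n → Prop}
    (hpow : ∀ r, P (2 ^ r) Nat.one_le_two_pow)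
    (hadd : ∀ r l, ∀ h : 1 ≤ l, l < 2 ^ r → P l h → P (2 ^ r + l) (h.trans (Nat.le_add_left _ _)))
    (n : ℕ) (hn : 1 ≤ n) : P n hn := by
  induction n using Nat.strong_induction_on with
  | _ n ih =>
    have h1 := Nat.pow_log_le_self 2 (x := n) (by omega)
    have h2 := Nat.lt_pow_succ_log_self one_lt_two n
    rw [pow_succ] at h2
    obtain ⟨l, hl⟩ := Nat.exists_eq_add_of_le h1
    generalize Nat.log 2 n = r at *
    subst hl
    have hp : 1 ≤ 2 ^ r := Nat.one_le_two_pow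
    rcases Nat.eq_zero_or_pos l with rfl | h0
    · exact hpow _
    · exact hadd _ _ h0 (by omega) (ih l (by omega) h0)

theorem log_two_pow_add {r l : ℕ} (h : l < 2 ^ r) : Nat.log 2 (2 ^ r + l) = r :=
  Nat.log_eq_of_pow_le_of_lt_pow (by omega) (by rw [pow_succ]; omega)

theorem sub_two_pow_log_lt {n : ℕ} (hn : n ≠ 0) : n - 2 ^ Nat.log 2 n < n :=
  Nat.sub_lt (Nat.pos_of_ne_zero hn) (Nat.two_pow_pos _)

/-- The number of ones in the binary expansion of `n`. -/
def binaryWeight (n : ℕ) : ℕ :=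
  if h : n = 0 then 0 else binaryWeight (n - 2 ^ Nat.log 2 n) + 1
termination_by n
decreasing_by exact sub_two_pow_log_lt h

theorem binaryWeight_zero : binaryWeight 0 = 0 := by
  rw [binaryWeight]; simp

theorem binaryWeight_two_pow_add {r l : ℕ} (h : l < 2 ^ r) :
    binaryWeight (2 ^ r + l) = binaryWeight l + 1 := by
  have hp := Nat.two_pow_pos r
  rw [binaryWeight, dif_neg (by omega), log_two_pow_add h, Nat.add_sub_cancel_left]

theorem binaryWeight_two_pow (r : ℕ) : binaryWeight (2 ^ r) = 1 := by
  have := binaryWeight_two_pow_add (Nat.two_pow_pos r)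
  rwa [add_zero, binaryWeight_zero] at this

theorem one_le_binaryWeight {n : ℕ} (hn : 1 ≤ n) : 1 ≤ binaryWeight n := by
  rw [binaryWeight, dif_neg (by omega)]; omega

theorem binaryWeight_le_pred_add_one (n : ℕ) (hn : 1 ≤ n) :
    binaryWeight n ≤ binaryWeight (n - 1) + 1 := by
  induction n, hn using two_pow_add_induction with
  | hpow r => rw [binaryWeight_two_pow]; omega
  | hadd r l h1 h2 ih =>
    rw [binaryWeight_two_pow_add h2, Nat.add_sub_assoc h1, binaryWeight_two_pow_add (by omega)]
    omega

theorem binaryWeight_le_pred_of_even (n : ℕ) (hn : 1 ≤ n) (he : Even n) :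
    binaryWeight n ≤ binaryWeight (n - 1) := by
  induction n, hn using two_pow_add_induction with
  | hpow r =>
    rw [binaryWeight_two_pow]
    refine one_le_binaryWeight ?_
    have := Nat.two_pow_pos r
    obtain ⟨c, hc⟩ := he
    omega
  | hadd r l h1 h2 ih =>
    rw [binaryWeight_two_pow_add h2, Nat.add_sub_assoc h1, binaryWeight_two_pow_add (by omega)]
    have hr : Even (2 ^ r) := by
      refine (Nat.even_pow.2 ⟨even_two, ?_⟩)
      rintro rfl
      simp at h2
      omega
    have := ih ((Nat.even_add.1 he).1 hr)
    omega

theorem sum_range_two_pow_succ {M : Type*} [AddCommMonoid M] (f : ℕ → M) (s : ℕ) :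
    ∑ i ∈ Finset.range (2 ^ (s + 1)), f i =
      ∑ i ∈ Finset.range (2 ^ s), f i + ∑ i ∈ Finset.range (2 ^ s), f (2 ^ s + i) := by
  rw [pow_succ, mul_two, Finset.sum_range_add]

theorem sum_binaryWeight (s : ℕ) :
    ∑ i ∈ Finset.range (2 ^ s), (binaryWeight i : ℝ) = s * 2 ^ s / 2 := by
  induction s with
  | zero => simp [binaryWeight_zero]
  | succ s ih =>
    have : ∑ i ∈ Finset.range (2 ^ s), (binaryWeight (2 ^ s + i) : ℝ) =
        ∑ i ∈ Finset.range (2 ^ s), ((binaryWeight i : ℝ) + 1) :=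
      Finset.sum_congr rfl fun i hi => by
        rw [binaryWeight_two_pow_add (Finset.mem_range.1 hi)]; push_cast; rfl
    rw [sum_range_two_pow_succ, this, Finset.sum_add_distrib, ih]
    simp
    ring

/-- Each binary digit contributes a factor `1 + 1/2`. This sum measures the total loss in the growth
estimate over one block of indices. -/
theorem sum_half_pow_binaryWeight (s : ℕ) :
    ∑ i ∈ Finset.range (2 ^ s), (1 / 2 : ℝ) ^ binaryWeight i = (3 / 2) ^ s := by
  induction s with
  | zero => simp [binaryWeight_zero]
  | succ s ih =>
    have : ∑ i ∈ Finset.range (2 ^ s), (1 / 2 : ℝ) ^ binaryWeight (2 ^ s + i) =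
        ∑ i ∈ Finset.range (2 ^ s), (1 / 2 : ℝ) ^ binaryWeight i * (1 / 2) :=
      Finset.sum_congr rfl fun i hi => by
        rw [binaryWeight_two_pow_add (Finset.mem_range.1 hi), pow_succ]
    rw [sum_range_two_pow_succ, this, ← Finset.sum_mul, ih]
    ring

/-! ### Flats of binary expansions -/

/-- For `l ≥ 1`, an affine subspace over `𝔽₂` of the set of binary expansions, of dimension
`binaryWeight l`, that contains `l` and `l - 1` and has no elements above `l`. -/
def initialFlat (l : ℕ) : Finset ℕ :=
  if h : l ≤ 2 ^ Nat.log 2 l then {l, l - 1}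
  else initialFlat (l - 2 ^ Nat.log 2 l) ∪
    (initialFlat (l - 2 ^ Nat.log 2 l)).image (2 ^ Nat.log 2 l + ·)
termination_by l
decreasing_by all_goals exact sub_two_pow_log_lt (by rintro rfl; simp at h)

theorem initialFlat_two_pow (r : ℕ) : initialFlat (2 ^ r) = {2 ^ r, 2 ^ r - 1} := by
  rw [initialFlat, dif_pos (by rw [Nat.log_pow one_lt_two])]

theorem initialFlat_two_pow_add {r l : ℕ} (h1 : 1 ≤ l) (h2 : l < 2 ^ r) :
    initialFlat (2 ^ r + l) = initialFlat l ∪ (initialFlat l).image (2 ^ r + ·) := by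
  rw [initialFlat, dif_neg (by rw [log_two_pow_add h2]; omega), log_two_pow_add h2,
    Nat.add_sub_cancel_left]

theorem le_of_mem_initialFlat (l : ℕ) (hl : 1 ≤ l) : ∀ g ∈ initialFlat l, g ≤ l := by
  induction l, hl using two_pow_add_induction with
  | hpow r => simp [initialFlat_two_pow]
  | hadd r l h1 h2 ih =>
    intro g hg
    rw [initialFlat_two_pow_add h1 h2, Finset.mem_union, Finset.mem_image] at hg
    rcases hg with hg | ⟨a, ha, rfl⟩
    · have := ih g hg; omega
    · have := ih a ha; omega

theorem self_mem_initialFlat (l : ℕ) (hl : 1 ≤ l) : l ∈ initialFlat l ∧ l - 1 ∈ initialFlat l := by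
  induction l, hl using two_pow_add_induction with
  | hpow r => simp [initialFlat_two_pow]
  | hadd r l h1 h2 ih =>
    rw [initialFlat_two_pow_add h1 h2, Finset.mem_union, Finset.mem_image, Finset.mem_union,
      Finset.mem_image]
    exact ⟨Or.inr ⟨l, ih.1, rfl⟩, Or.inr ⟨l - 1, ih.2, by omega⟩⟩

/-- Supplies a vanishing term `x (2 ^ s + 0)` in the recursion, needed where the general growth
estimate is too weak. -/
theorem zero_mem_initialFlat (l : ℕ) (hl : 1 ≤ l) (ho : Odd l) : 0 ∈ initialFlat l := by
  induction l, hl using two_pow_add_induction with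
  | hpow r =>
    obtain rfl : r = 0 := by
      by_contra h
      exact Nat.not_even_iff_odd.2 ho (Nat.even_pow.2 ⟨even_two, h⟩)
    rw [initialFlat_two_pow]
    simp
  | hadd r l h1 h2 ih =>
    rw [initialFlat_two_pow_add h1 h2, Finset.mem_union]
    have hr : Even (2 ^ r) := by
      refine (Nat.even_pow.2 ⟨even_two, ?_⟩)
      rintro rfl
      simp at h2
      omega
    exact Or.inl (ih ((Nat.odd_add'.1 ho).2 hr))

theorem disjoint_initialFlat_image {r l : ℕ} (h1 : 1 ≤ l) (h2 : l < 2 ^ r) :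
    Disjoint (initialFlat l) ((initialFlat l).image (2 ^ r + ·)) := by
  rw [Finset.disjoint_left]
  intro g hg hg'
  obtain ⟨a, -, rfl⟩ := Finset.mem_image.1 hg'
  have := le_of_mem_initialFlat l h1 _ hg
  omega

theorem card_initialFlat (l : ℕ) (hl : 1 ≤ l) : (initialFlat l).card = 2 ^ binaryWeight l := by
  induction l, hl using two_pow_add_induction with
  | hpow r =>
    have := Nat.two_pow_pos r
    rw [initialFlat_two_pow, binaryWeight_two_pow, Finset.card_pair (by omega), pow_one]
  | hadd r l h1 h2 ih =>
    rw [initialFlat_two_pow_add h1 h2, Finset.card_union_of_disjoint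
      (disjoint_initialFlat_image h1 h2), Finset.card_image_of_injective _
      (add_right_injective _), ih, binaryWeight_two_pow_add h2, pow_succ, mul_two]

/-! ### Walsh functions -/

/-- The sign by which the `s`-th binary digit of `b` acts. -/
def bitSign (s b : ℕ) : ℝ := if b.testBit s then -1 else 1

theorem bitSign_eq (s b : ℕ) : bitSign s b = 1 ∨ bitSign s b = -1 := by
  unfold bitSign; split <;> simp

/-- The Walsh function `(-1) ^ |j ∩ b|`, where `j` and `b` stand for sets of positions `< m`
by their binary expansions. -/
def walsh (m j b : ℕ) : ℝ := ∏ s ∈ Finset.range m, if j.testBit s then bitSign s b else 1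

theorem walsh_eq (m j b : ℕ) : walsh m j b = 1 ∨ walsh m j b = -1 := by
  unfold walsh
  refine Finset.prod_induction _ (fun r : ℝ => r = 1 ∨ r = -1) ?_ (Or.inl rfl) ?_
  · rintro a c (rfl | rfl) (rfl | rfl) <;> simp
  · intro s _
    split
    · exact bitSign_eq s b
    · exact Or.inl rfl

theorem walsh_zero_left (m b : ℕ) : walsh m 0 b = 1 := by
  simp [walsh]

theorem walsh_two_pow_add {m s l : ℕ} (hs : s < m) (hl : l < 2 ^ s) (b : ℕ) :
    walsh m (2 ^ s + l) b = bitSign s b * walsh m l b := by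
  unfold walsh
  rw [← Finset.mul_prod_erase _ _ (Finset.mem_range.2 hs),
    ← Finset.mul_prod_erase (Finset.range m) _ (Finset.mem_range.2 hs),
    Nat.testBit_two_pow_add_eq, Nat.testBit_lt_two_pow hl]
  simp only [Bool.not_false, if_true, Bool.false_eq_true, if_false, one_mul]
  congr 1
  refine Finset.prod_congr rfl fun t ht => ?_
  rcases lt_or_gt_of_ne (Finset.ne_of_mem_erase ht) with h | h
  · rw [Nat.testBit_two_pow_add_gt h]
  · have h3 : 2 ^ (s + 1) ≤ 2 ^ t := Nat.pow_le_pow_right (by norm_num) h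
    rw [pow_succ] at h3
    rw [Nat.testBit_lt_two_pow (show 2 ^ s + l < 2 ^ t by omega),
      Nat.testBit_lt_two_pow (show l < 2 ^ t by omega)]

theorem walsh_add_one_of_even {m j : ℕ} (hm : 0 < m) (hj : Even j) (b : ℕ) :
    walsh m (j + 1) b = bitSign 0 b * walsh m j b := by
  obtain ⟨m, rfl⟩ : ∃ k, m = k + 1 := ⟨m - 1, by omega⟩
  obtain ⟨c, rfl⟩ := hj
  unfold walsh
  rw [Finset.prod_range_succ', Finset.prod_range_succ']
  have h0 : (c + c + 1).testBit 0 = true := by simp; omega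
  have h1 : (c + c).testBit 0 = false := by simp; omega
  have h2 : ∀ k, (c + c + 1).testBit (k + 1) = (c + c).testBit (k + 1) := by
    intro k
    rw [Nat.testBit_succ, Nat.testBit_succ]
    congr 1
    omega
  simp only [h0, h1, h2, if_true, Bool.false_eq_true, if_false, mul_one]
  ring

theorem sum_prod_testBit (m : ℕ) (g : ℕ → Bool → ℝ) :
    ∑ b ∈ Finset.range (2 ^ m), ∏ s ∈ Finset.range m, g s (b.testBit s) =
      ∏ s ∈ Finset.range m, (g s false + g s true) := by
  induction m with
  | zero => simp
  | succ m ih =>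
    rw [sum_range_two_pow_succ, Finset.prod_range_succ, ← ih, mul_add, Finset.sum_mul,
      Finset.sum_mul]
    congr 1
    · refine Finset.sum_congr rfl fun b hb => ?_
      rw [Finset.prod_range_succ, Nat.testBit_lt_two_pow (Finset.mem_range.1 hb)]
    · refine Finset.sum_congr rfl fun b hb => ?_
      rw [Finset.prod_range_succ, Nat.testBit_two_pow_add_eq,
        Nat.testBit_lt_two_pow (Finset.mem_range.1 hb), Bool.not_false]
      congr 1
      refine Finset.prod_congr rfl fun s hs => ?_
      rw [Nat.testBit_two_pow_add_gt (Finset.mem_range.1 hs)]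

theorem sum_walsh_mul_walsh {m i j : ℕ} (hi : i < 2 ^ m) (hj : j < 2 ^ m) :
    ∑ b ∈ Finset.range (2 ^ m), walsh m i b * walsh m j b = if i = j then 2 ^ m else 0 := by
  let g : ℕ → Bool → ℝ := fun s c =>
    (if i.testBit s then (if c then -1 else 1) else 1) *
      (if j.testBit s then (if c then -1 else 1) else 1)
  have h : ∀ b, walsh m i b * walsh m j b = ∏ s ∈ Finset.range m, g s (b.testBit s) := by
    intro b
    simp only [walsh, bitSign, g, ← Finset.prod_mul_distrib]
  simp only [h]
  rw [sum_prod_testBit]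
  split_ifs with hij
  · subst hij
    rw [Finset.prod_congr rfl (g := fun _ => (2 : ℝ))]
    · simp
    · intro s _
      cases h : i.testBit s <;> simp [g, h] <;> norm_num
  · obtain ⟨s, hs⟩ := Nat.exists_testBit_ne_of_ne hij
    have hsm : s < m := by
      by_contra hsm
      have hle : 2 ^ m ≤ 2 ^ s := Nat.pow_le_pow_right (by norm_num) (by omega)
      rw [Nat.testBit_lt_two_pow (by omega), Nat.testBit_lt_two_pow (by omega)] at hs
      exact hs rfl
    refine Finset.prod_eq_zero (Finset.mem_range.2 hsm) ?_
    cases h1 : i.testBit s <;> cases h2 : j.testBit s <;> simp_all [g]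

/-- A Walsh function is balanced or constant on an initial flat. -/
theorem sum_walsh_initialFlat (m b : ℕ) (l : ℕ) (hl : 1 ≤ l) (hlm : l < 2 ^ m) :
    ∑ g ∈ initialFlat l, walsh m g b = 0 ∨ ∀ g ∈ initialFlat l, walsh m g b = walsh m l b := by
  induction l, hl using two_pow_add_induction with
  | hpow r =>
    have := Nat.two_pow_pos r
    rw [initialFlat_two_pow, Finset.sum_pair (by omega)]
    rcases walsh_eq m (2 ^ r) b with h1 | h1 <;> rcases walsh_eq m (2 ^ r - 1) b with h2 | h2 <;>
      simp [h1, h2]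
  | hadd r l h1 h2 ih =>
    have hrm : r < m := (Nat.pow_lt_pow_iff_right (a := 2) (by norm_num)).1 (by omega)
    have hw : ∀ g ∈ initialFlat l, walsh m (2 ^ r + g) b = bitSign r b * walsh m g b :=
      fun g hg => walsh_two_pow_add hrm ((le_of_mem_initialFlat l h1 g hg).trans_lt h2) b
    rw [initialFlat_two_pow_add h1 h2, Finset.sum_union (disjoint_initialFlat_image h1 h2),
      Finset.sum_image fun _ _ _ _ h => add_right_injective _ h, Finset.sum_congr rfl hw,
      ← Finset.mul_sum, walsh_two_pow_add hrm h2]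
    -- On the translate by `2 ^ r` the function is multiplied by this sign: `-1` makes the two
    -- halves cancel, `1` reduces the claim to the smaller flat.
    rcases bitSign_eq r b with hb | hb
    · rcases ih (by omega) with h | h
      · left; rw [h]; simp
      · right
        intro g hg
        rw [Finset.mem_union, Finset.mem_image] at hg
        rcases hg with hg | ⟨a, ha, rfl⟩
        · rw [h g hg, hb, one_mul]
        · rw [hw a ha, h a ha]
    · left; rw [hb]; ring

/-! ### The triangular system -/

/-- The `i`-th row of the lower triangular matrix of Alon and Vũ, as a linear functional on
sequences. -/
noncomputable def triangularRow (i : ℕ) : (ℕ → ℝ) →ₗ[ℝ] ℝ :=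
  let e : ℕ → (ℕ → ℝ) →ₗ[ℝ] ℝ := fun j => LinearMap.proj j
  let s := Nat.log 2 i
  -- For `i = 0` the logarithm is `0` and truncated subtraction gives `l = 0`, so row `0` is a unit
  -- row.
  let l := i - 2 ^ s
  if l = 0 then e i
  -- The general formula would give `x (2 ^ s + 1) = x (2 ^ s) + x 1 + x 0 = 1` and restart the
  -- growth in each block; this row carries over the values at the end of the previous block.
  else if l = 1 then (1 / 2 : ℝ) • (e i - e (2 ^ s) - e (2 ^ s - 1) - e (2 ^ s - 2))
  else (1 / 2 ^ binaryWeight l : ℝ) • ∑ g ∈ initialFlat l, (e (2 ^ s + g) - e g) - e (i - 1)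

theorem triangularRow_zero (f : ℕ → ℝ) : triangularRow 0 f = f 0 := by
  simp [triangularRow]

theorem triangularRow_two_pow (s : ℕ) (f : ℕ → ℝ) : triangularRow (2 ^ s) f = f (2 ^ s) := by
  simp [triangularRow, Nat.log_pow]

theorem triangularRow_two_pow_add_one {s : ℕ} (hs : 1 ≤ s) (f : ℕ → ℝ) :
    triangularRow (2 ^ s + 1) f =
      1 / 2 * (f (2 ^ s + 1) - f (2 ^ s) - f (2 ^ s - 1) - f (2 ^ s - 2)) := by
  have h : 1 < 2 ^ s := Nat.one_lt_two_pow (by omega)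
  simp only [triangularRow, log_two_pow_add h, Nat.add_sub_cancel_left]
  simp

theorem triangularRow_two_pow_add {s l : ℕ} (h1 : 2 ≤ l) (h2 : l < 2 ^ s) (f : ℕ → ℝ) :
    triangularRow (2 ^ s + l) f = 1 / 2 ^ binaryWeight l *
      ∑ g ∈ initialFlat l, (f (2 ^ s + g) - f g) - f (2 ^ s + l - 1) := by
  simp only [triangularRow, log_two_pow_add h2, Nat.add_sub_cancel_left]
  rw [if_neg (by omega), if_neg (by omega)]
  simp

theorem triangularRow_two_pow_add_eq_iff {s l : ℕ} (h1 : 2 ≤ l) (h2 : l < 2 ^ s) (f : ℕ → ℝ) :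
    triangularRow (2 ^ s + l) f = 0 ↔
      f (2 ^ s + l) = 2 ^ binaryWeight l * f (2 ^ s + l - 1) -
        ∑ g ∈ (initialFlat l).erase l, f (2 ^ s + g) + ∑ g ∈ initialFlat l, f g := by
  rw [triangularRow_two_pow_add h1 h2, Finset.sum_sub_distrib,
    ← Finset.add_sum_erase _ _ (self_mem_initialFlat l (by omega)).1]
  have : (0 : ℝ) < 2 ^ binaryWeight l := by positivity
  rw [sub_eq_zero, one_div, inv_mul_eq_iff_eq_mul₀ this.ne']
  constructor <;> intro h <;> linarith

/-- A case distinction for natural numbers by their leading binary digit. -/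
theorem two_pow_cases (i : ℕ) : i = 0 ∨ (∃ s, i = 2 ^ s) ∨ (∃ s, 1 ≤ s ∧ i = 2 ^ s + 1) ∨
    ∃ s l, 2 ≤ l ∧ l < 2 ^ s ∧ i = 2 ^ s + l := by
  rcases Nat.eq_zero_or_pos i with h | h
  · exact Or.inl h
  right
  induction i, h using two_pow_add_induction with
  | hpow r => exact Or.inl ⟨r, rfl⟩
  | hadd r l h1 h2 _ =>
    right
    rcases h1.eq_or_lt with rfl | h
    · refine Or.inl ⟨r, ?_, rfl⟩
      by_contra h
      obtain rfl : r = 0 := by omega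
      simp at h2
    · exact Or.inr ⟨r, l, h, h2, rfl⟩

theorem eq_zero_of_triangularRow_eq_zero {N : ℕ} {f : ℕ → ℝ}
    (h : ∀ i < N, triangularRow i f = 0) : ∀ i < N, f i = 0 := by
  intro i
  induction i using Nat.strong_induction_on with
  | _ i ih =>
    intro hi
    have hr := h i hi
    rcases two_pow_cases i with rfl | ⟨s, rfl⟩ | ⟨s, hs, rfl⟩ | ⟨s, l, h1, h2, rfl⟩
    · rwa [triangularRow_zero] at hr
    · rwa [triangularRow_two_pow] at hr
    · have := Nat.one_lt_two_pow (n := s) (by omega)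
      rw [triangularRow_two_pow_add_one hs, ih (2 ^ s) (by omega) (by omega),
        ih (2 ^ s - 1) (by omega) (by omega), ih (2 ^ s - 2) (by omega) (by omega)] at hr
      linarith
    · rw [triangularRow_two_pow_add_eq_iff h1 h2] at hr
      rw [hr, ih (2 ^ s + l - 1) (by omega) (by omega), Finset.sum_eq_zero, Finset.sum_eq_zero]
      · simp
      · intro g hg
        have := le_of_mem_initialFlat l (by omega) g hg
        exact ih g (by omega) (by omega)
      · intro g hg
        have h3 := le_of_mem_initialFlat l (by omega) g (Finset.mem_of_mem_erase hg)
        have h4 := Finset.ne_of_mem_erase hg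
        exact ih _ (by omega) (by omega)

/-- The sequence solves the triangular system whose right hand side is the unit vector at `1`. -/
def IsTriangularSolution (N : ℕ) (x : ℕ → ℝ) : Prop :=
  ∀ i < N, triangularRow i x = if i = 1 then 1 else 0

/-! ### Growth of the solution -/

namespace IsTriangularSolution

variable {m : ℕ} {x : ℕ → ℝ}

theorem apply_zero (hx : IsTriangularSolution (2 ^ m) x) : x 0 = 0 := by
  have := hx 0 (Nat.two_pow_pos m)
  simpa [triangularRow_zero] using this

theorem apply_one (hx : IsTriangularSolution (2 ^ m) x) (hm : 1 ≤ m) : x 1 = 1 := by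
  have := hx 1 (Nat.one_lt_two_pow (by omega))
  rw [← pow_zero 2, triangularRow_two_pow] at this
  simpa using this

theorem apply_two_pow (hx : IsTriangularSolution (2 ^ m) x) {s : ℕ} (hs : 1 ≤ s) (hsm : s < m) :
    x (2 ^ s) = 0 := by
  have h1 : 1 < 2 ^ s := Nat.one_lt_two_pow (by omega)
  have := hx (2 ^ s) (Nat.pow_lt_pow_right (by norm_num) hsm)
  rwa [triangularRow_two_pow, if_neg (by omega)] at this

theorem two_pow_add_lt {m s l : ℕ} (hsm : s < m) (hl : l < 2 ^ s) : 2 ^ s + l < 2 ^ m := by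
  have : 2 ^ (s + 1) ≤ 2 ^ m := Nat.pow_le_pow_right (by norm_num) hsm
  rw [pow_succ] at this
  omega

theorem apply_two_pow_add_one (hx : IsTriangularSolution (2 ^ m) x) {s : ℕ} (hs : 1 ≤ s)
    (hsm : s < m) : x (2 ^ s + 1) = x (2 ^ s - 1) + x (2 ^ s - 2) := by
  have h1 : 1 < 2 ^ s := Nat.one_lt_two_pow (by omega)
  have := hx (2 ^ s + 1) (two_pow_add_lt hsm h1)
  rw [triangularRow_two_pow_add_one hs, if_neg (by omega), hx.apply_two_pow hs hsm] at this
  linarith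

theorem apply_two_pow_add (hx : IsTriangularSolution (2 ^ m) x) {s l : ℕ} (h1 : 2 ≤ l)
    (h2 : l < 2 ^ s) (hsm : s < m) :
    x (2 ^ s + l) = 2 ^ binaryWeight l * x (2 ^ s + l - 1) -
        ∑ g ∈ (initialFlat l).erase l, x (2 ^ s + g) + ∑ g ∈ initialFlat l, x g := by
  have := hx (2 ^ s + l) (two_pow_add_lt hsm h2)
  rwa [if_neg (by omega), triangularRow_two_pow_add_eq_iff h1 h2] at this

/-- The recursion has `2 ^ w x(i-1)` minus `2 ^ w - 1` earlier terms of the block, each at most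
`x(i-1)`, plus nonnegative terms; hence `x i ≥ x (i-1)`. Powers `2 ^ s` with `s ≥ 1` are exceptions
because the entry there is zero. -/
theorem nonneg_and_monotone (hx : IsTriangularSolution (2 ^ m) x) (i : ℕ) (hi : i < 2 ^ m) :
    0 ≤ x i ∧ ((∀ s, 1 ≤ s → i ≠ 2 ^ s) → ∀ j ≤ i, x j ≤ x i) := by
  induction i using Nat.strong_induction_on with
  | _ i ih =>
  have hlt : ∀ {s l}, 2 ^ s + l < 2 ^ m → s < m := fun {s l} h =>
    (Nat.pow_lt_pow_iff_right (a := 2) (by norm_num)).1 (by omega)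
  rcases two_pow_cases i with rfl | ⟨s, rfl⟩ | ⟨s, hs, rfl⟩ | ⟨s, l, h1, h2, rfl⟩
  · refine ⟨hx.apply_zero.ge, fun _ j hj => ?_⟩
    rw [Nat.le_zero.1 hj]
  · have hsm := hlt (l := 0) hi
    rcases Nat.eq_zero_or_pos s with rfl | hs
    · rw [pow_zero, hx.apply_one (by omega)]
      refine ⟨zero_le_one, fun _ j hj => ?_⟩
      interval_cases j
      · rw [hx.apply_zero]; exact zero_le_one
      · rw [hx.apply_one (by omega)]
    · exact ⟨(hx.apply_two_pow hs hsm).ge, fun h => absurd rfl (h s hs)⟩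
  · have hsm := hlt hi
    have hs1 : 1 < 2 ^ s := Nat.one_lt_two_pow (by omega)
    have e := hx.apply_two_pow_add_one hs hsm
    have p1 := (ih (2 ^ s - 1) (by omega) (by omega)).1
    have p2 := (ih (2 ^ s - 2) (by omega) (by omega)).1
    have h0 := hx.apply_two_pow hs hsm
    refine ⟨by linarith, fun _ j hj => ?_⟩
    rcases hj.eq_or_lt with rfl | hj
    · exact le_rfl
    rcases (Nat.lt_succ_iff.1 hj).eq_or_lt with rfl | hj
    · linarith
    have := (ih (2 ^ s - 1) (by omega) (by omega)).2 (by
      intro t ht heq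
      rcases hs.eq_or_lt with rfl | hs
      · have : 2 ^ 1 ≤ 2 ^ t := Nat.pow_le_pow_right (by norm_num) ht
        omega
      · have e1 : Even (2 ^ s) := Nat.even_pow.2 ⟨even_two, by omega⟩
        have e2 : Even (2 ^ t) := Nat.even_pow.2 ⟨even_two, by omega⟩
        obtain ⟨a, ha⟩ := e1
        obtain ⟨b, hb⟩ := e2
        omega) j (by omega)
    linarith
  · have hsm := hlt hi
    have e := hx.apply_two_pow_add h1 h2 hsm
    have hpred : ∀ j ≤ 2 ^ s + l - 1, x j ≤ x (2 ^ s + l - 1) := by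
      refine (ih (2 ^ s + l - 1) (by omega) (by omega)).2 fun t _ heq => ?_
      have h3 : s < t := (Nat.pow_lt_pow_iff_right (a := 2) (by norm_num)).1 (by omega)
      have h4 : 2 ^ (s + 1) ≤ 2 ^ t := Nat.pow_le_pow_right (by norm_num) h3
      rw [pow_succ] at h4
      omega
    have hsum : ∑ g ∈ (initialFlat l).erase l, x (2 ^ s + g) ≤
        (2 ^ binaryWeight l - 1) * x (2 ^ s + l - 1) := by
      have := Finset.sum_le_card_nsmul ((initialFlat l).erase l) (fun g => x (2 ^ s + g))
        (x (2 ^ s + l - 1)) fun g hg => by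
          have h3 := le_of_mem_initialFlat l (by omega) g (Finset.mem_of_mem_erase hg)
          have h4 := Finset.ne_of_mem_erase hg
          exact hpred _ (by omega)
      rw [Finset.card_erase_of_mem (self_mem_initialFlat l (by omega)).1,
        card_initialFlat l (by omega), nsmul_eq_mul, Nat.cast_sub Nat.one_le_two_pow] at this
      simpa using this
    have hsum2 : 0 ≤ ∑ g ∈ initialFlat l, x g := Finset.sum_nonneg fun g hg => by
      have h3 := le_of_mem_initialFlat l (by omega) g hg
      exact (ih g (by omega) (by omega)).1
    have hp := (ih (2 ^ s + l - 1) (by omega) (by omega)).1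
    have hstep : x (2 ^ s + l - 1) ≤ x (2 ^ s + l) := by linarith
    refine ⟨hp.trans hstep, fun _ j hj => ?_⟩
    rcases hj.eq_or_lt with rfl | hj
    · exact le_rfl
    · exact (hpred j (by omega)).trans hstep

theorem nonneg (hx : IsTriangularSolution (2 ^ m) x) {i : ℕ} (hi : i < 2 ^ m) : 0 ≤ x i :=
  (hx.nonneg_and_monotone i hi).1

theorem monotone (hx : IsTriangularSolution (2 ^ m) x) {s l : ℕ} (h1 : 1 ≤ l) (h2 : l < 2 ^ s)
    (hsm : s < m) {j : ℕ} (hj : j ≤ 2 ^ s + l) : x j ≤ x (2 ^ s + l) := by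
  refine (hx.nonneg_and_monotone _ (two_pow_add_lt hsm h2)).2 (fun t _ heq => ?_) j hj
  have h3 : s < t := (Nat.pow_lt_pow_iff_right (a := 2) (by norm_num)).1 (by omega)
  have h4 : 2 ^ (s + 1) ≤ 2 ^ t := Nat.pow_le_pow_right (by norm_num) h3
  rw [pow_succ] at h4
  omega

/-- The basic recursive estimate; the elements of `t` are indices of vanishing entries. -/
theorem le_apply_add (hx : IsTriangularSolution (2 ^ m) x) {s l : ℕ} (h1 : 2 ≤ l)
    (h2 : l < 2 ^ s) (hsm : s < m) (t : Finset ℕ)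
    (ht : t ⊆ ((initialFlat l).erase l).erase (l - 1)) (hxt : ∀ g ∈ t, x (2 ^ s + g) = 0)
    {c : ℝ} (hc : ∀ g, g + 2 ≤ l → x (2 ^ s + g) ≤ c) :
    (2 ^ binaryWeight l - 1) * x (2 ^ s + l - 1) - (2 ^ binaryWeight l - 2 - t.card) * c ≤
      x (2 ^ s + l) := by
  have e := hx.apply_two_pow_add h1 h2 hsm
  obtain ⟨m1, m2⟩ := self_mem_initialFlat l (by omega)
  have m3 : l - 1 ∈ (initialFlat l).erase l := Finset.mem_erase.2 ⟨by omega, m2⟩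
  have hnn : 0 ≤ ∑ g ∈ initialFlat l, x g := Finset.sum_nonneg fun g hg => by
    have h3 := le_of_mem_initialFlat l (by omega) g hg
    have := two_pow_add_lt hsm h2
    exact hx.nonneg (by omega)
  have hsum := Finset.sum_le_card_nsmul ((((initialFlat l).erase l).erase (l - 1)) \ t)
    (fun g => x (2 ^ s + g)) c fun g hg => by
      have hg1 := (Finset.mem_sdiff.1 hg).1
      have h3 := Finset.ne_of_mem_erase hg1
      have hg2 := Finset.mem_of_mem_erase hg1
      have h4 := Finset.ne_of_mem_erase hg2
      have h5 := le_of_mem_initialFlat l (by omega) g (Finset.mem_of_mem_erase hg2)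
      exact hc g (by omega)
  have hcard : (((((initialFlat l).erase l).erase (l - 1)) \ t).card : ℝ) =
      2 ^ binaryWeight l - 2 - t.card := by
    rw [Finset.cast_card_sdiff ht, Finset.cast_card_erase_of_mem m3,
      Finset.cast_card_erase_of_mem m1, card_initialFlat l (by omega)]
    push_cast
    ring
  rw [nsmul_eq_mul, hcard] at hsum
  rw [← Finset.add_sum_erase _ _ m3, ← Finset.sum_sdiff ht, Finset.sum_eq_zero hxt,
    ← Nat.add_sub_assoc (by omega)] at e
  linarith

/-- If the previous step at least doubled, then `le_apply_add` with `c` half of the preceding entry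
gives `(2 ^ w - 1) - (2 ^ w - 2) / 2 = 2 ^ w / 2`. -/
theorem mul_le_apply_of_weight (hx : IsTriangularSolution (2 ^ m) x) {s : ℕ} (hsm : s < m)
    (l : ℕ) (h1 : 2 ≤ l) (h2 : l < 2 ^ s) :
    2 ^ binaryWeight l * x (2 ^ s + l - 1) ≤ 2 * x (2 ^ s + l) := by
  induction l using Nat.strong_induction_on with
  | _ l ih =>
  have hw1 := one_le_binaryWeight (n := l) (by omega)
  have hnn : 0 ≤ x (2 ^ s + l - 1) := hx.nonneg (by have := two_pow_add_lt hsm h2; omega)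
  rcases hw1.eq_or_lt with hw | hw
  · rw [← hw]
    have := hx.monotone (by omega) h2 hsm (j := 2 ^ s + l - 1) (by omega)
    linarith
  have h3 : 3 ≤ l := by
    by_contra h
    obtain rfl : l = 2 ^ 1 := by omega
    rw [binaryWeight_two_pow] at hw
    omega
  have hc : ∀ g, g + 2 ≤ l → x (2 ^ s + g) ≤ x (2 ^ s + (l - 2)) := fun g hg =>
    hx.monotone (by omega) (by omega) hsm (by omega)
  -- Only here may `l - 1` have weight `1`, with no doubling before. The zero entry at `2 ^ s` saves
  -- one term: `3 - 1 = 2`.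
  by_cases hcase : binaryWeight l = 2 ∧ Odd l
  · have hs1 : 1 ≤ s := by
      by_contra h
      obtain rfl : s = 0 := by omega
      simp at h2
      omega
    have := hx.le_apply_add h1 h2 hsm {0} (by
      rw [Finset.singleton_subset_iff, Finset.mem_erase, Finset.mem_erase]
      exact ⟨by omega, by omega, zero_mem_initialFlat l (by omega) hcase.2⟩) (by
      intro g hg
      rw [Finset.mem_singleton.1 hg, add_zero, hx.apply_two_pow hs1 hsm]) hc
    rw [hcase.1] at this ⊢
    have hm := hx.monotone (s := s) (l := l - 1) (by omega) (by omega) hsm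
      (j := 2 ^ s + (l - 2)) (by omega)
    rw [show 2 ^ s + (l - 1) = 2 ^ s + l - 1 by omega] at hm
    norm_num at this ⊢
    linarith
  · have hwp : 2 ≤ binaryWeight (l - 1) := by
      have h4 := binaryWeight_le_pred_add_one l (by omega)
      by_cases ho : Odd l
      · have : binaryWeight l ≠ 2 := fun h => hcase ⟨h, ho⟩
        omega
      · have := binaryWeight_le_pred_of_even l (by omega) (Nat.not_odd_iff_even.1 ho)
        omega
    have := hx.le_apply_add h1 h2 hsm ∅ (Finset.empty_subset _) (by simp) hc
    have hi := ih (l - 1) (by omega) (by omega) (by omega)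
    rw [show 2 ^ s + (l - 1) - 1 = 2 ^ s + (l - 2) by omega,
      show 2 ^ s + (l - 1) = 2 ^ s + l - 1 by omega] at hi
    have h4 : (2 : ℝ) ^ 2 ≤ 2 ^ binaryWeight (l - 1) := pow_le_pow_right₀ (by norm_num) hwp
    have h5 : (2 : ℝ) ^ 2 ≤ 2 ^ binaryWeight l := pow_le_pow_right₀ (by norm_num) hw
    have h6 : 0 ≤ x (2 ^ s + (l - 2)) :=
      hx.nonneg (by have := two_pow_add_lt hsm h2; omega)
    have h7 : 2 * x (2 ^ s + (l - 2)) ≤ x (2 ^ s + l - 1) := by nlinarith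
    rw [Finset.card_empty] at this
    push_cast at this
    nlinarith

/-- Bootstraps the previous bound: the weight of `l - 1` is at least `w - 1`, so the `2 ^ w - 2`
subtracted terms total at most four times the preceding entry. -/
theorem sub_mul_le_apply (hx : IsTriangularSolution (2 ^ m) x) {s l : ℕ} (hsm : s < m)
    (h2 : l < 2 ^ s) (hw : 3 ≤ binaryWeight l) :
    (2 ^ binaryWeight l - 5) * x (2 ^ s + l - 1) ≤ x (2 ^ s + l) := by
  have h3 : 3 ≤ l := by
    by_contra h
    have : l ≤ 2 := by omega
    interval_cases l
    · rw [binaryWeight_zero] at hw; omega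
    · rw [← pow_zero 2, binaryWeight_two_pow] at hw; omega
    · rw [← pow_one 2, binaryWeight_two_pow] at hw; omega
  have hc : ∀ g, g + 2 ≤ l → x (2 ^ s + g) ≤ x (2 ^ s + (l - 2)) := fun g hg =>
    hx.monotone (by omega) (by omega) hsm (by omega)
  have := hx.le_apply_add (by omega) h2 hsm ∅ (Finset.empty_subset _) (by simp) hc
  have hi := hx.mul_le_apply_of_weight hsm (l - 1) (by omega) (by omega)
  rw [show 2 ^ s + (l - 1) - 1 = 2 ^ s + (l - 2) by omega,
    show 2 ^ s + (l - 1) = 2 ^ s + l - 1 by omega] at hi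
  have h4 : (2 : ℝ) ^ binaryWeight l ≤ 2 ^ (binaryWeight (l - 1) + 1) :=
    pow_le_pow_right₀ (by norm_num) (binaryWeight_le_pred_add_one l (by omega))
  have h6 : 0 ≤ x (2 ^ s + (l - 2)) := hx.nonneg (by have := two_pow_add_lt hsm h2; omega)
  have h7 := mul_le_mul_of_nonneg_right h4 h6
  rw [pow_succ] at h7
  rw [Finset.card_empty] at this
  push_cast at this
  linarith

end IsTriangularSolution

theorem two_rpow_neg_le {y : ℝ} (h0 : 0 ≤ y) (h1 : y ≤ 1 / 32) :
    (2 : ℝ) ^ (-(16 * y)) ≤ 1 - 5 * y := by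
  have h2 : 1 + 11 * y ≤ (2 : ℝ) ^ (16 * y) := by
    rw [Real.rpow_def_of_pos two_pos]
    have := Real.add_one_le_exp (Real.log 2 * (16 * y))
    have := Real.log_two_gt_d9
    nlinarith
  rw [Real.rpow_neg two_pos.le]
  calc ((2 : ℝ) ^ (16 * y))⁻¹ ≤ (1 + 11 * y)⁻¹ := inv_anti₀ (by positivity) h2
    _ ≤ 1 - 5 * y := by
      rw [inv_le_iff_one_le_mul₀ (by positivity)]
      nlinarith

namespace IsTriangularSolution

variable {m : ℕ} {x : ℕ → ℝ}

/-- For weight at most `4` the allowed loss is at least one bit, which the bound up to a factor `2`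
affords; from weight `5` on, `2 ^ w - 5` is used. -/
theorem rpow_mul_le_apply (hx : IsTriangularSolution (2 ^ m) x) {s l : ℕ} (hsm : s < m)
    (h1 : 2 ≤ l) (h2 : l < 2 ^ s) :
    (2 : ℝ) ^ ((binaryWeight l : ℝ) - 16 * (1 / 2) ^ binaryWeight l) * x (2 ^ s + l - 1) ≤
      x (2 ^ s + l) := by
  have hnn : 0 ≤ x (2 ^ s + l - 1) := hx.nonneg (by have := two_pow_add_lt hsm h2; omega)
  rw [sub_eq_add_neg, Real.rpow_add two_pos, Real.rpow_natCast]
  rcases le_or_gt (binaryWeight l) 4 with hw | hw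
  · refine le_trans ?_ (show 2 ^ binaryWeight l * (1 / 2) * x (2 ^ s + l - 1) ≤ _ by
      have := hx.mul_le_apply_of_weight hsm l h1 h2
      linarith)
    gcongr
    have h3 : (1 / 2 : ℝ) ^ 4 ≤ (1 / 2) ^ binaryWeight l :=
      pow_le_pow_of_le_one (by norm_num) (by norm_num) hw
    calc (2 : ℝ) ^ (-(16 * (1 / 2) ^ binaryWeight l) : ℝ) ≤ 2 ^ (-1 : ℝ) :=
          Real.rpow_le_rpow_of_exponent_le (by norm_num) (by norm_num at h3 ⊢; linarith)
      _ = 1 / 2 := by rw [Real.rpow_neg_one]; norm_num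
  · refine le_trans ?_ (hx.sub_mul_le_apply hsm h2 (by omega))
    gcongr
    have h3 : (1 / 2 : ℝ) ^ binaryWeight l ≤ (1 / 2) ^ 5 :=
      pow_le_pow_of_le_one (by norm_num) (by norm_num) hw
    have h4 := two_rpow_neg_le (y := (1 / 2) ^ binaryWeight l) (by positivity)
      (by norm_num at h3 ⊢; linarith)
    calc _ ≤ (2 : ℝ) ^ binaryWeight l * (1 - 5 * (1 / 2) ^ binaryWeight l) := by gcongr
      _ = 2 ^ binaryWeight l - 5 := by
        rw [mul_sub, mul_one, mul_left_comm, ← mul_pow]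
        norm_num

theorem logb_apply_two_pow_add (hx : IsTriangularSolution (2 ^ m) x) {s : ℕ} (hs : 1 ≤ s)
    (hsm : s < m) (hpos : 0 < x (2 ^ s - 1)) (l : ℕ) (h1 : 1 ≤ l) (h2 : l < 2 ^ s) :
    0 < x (2 ^ s + l) ∧ Real.logb 2 (x (2 ^ s - 1)) +
      ∑ i ∈ Finset.range (l + 1), ((binaryWeight i : ℝ) - 16 * (1 / 2) ^ binaryWeight i) ≤
        Real.logb 2 (x (2 ^ s + l)) := by
  induction l, h1 using Nat.le_induction with
  | base =>
    have e := hx.apply_two_pow_add_one hs hsm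
    have hlt : 2 ^ s < 2 ^ m := Nat.pow_lt_pow_right (by norm_num) hsm
    have hnn : 0 ≤ x (2 ^ s - 2) := hx.nonneg (by omega)
    have hle : x (2 ^ s - 1) ≤ x (2 ^ s + 1) := by linarith
    refine ⟨by linarith, ?_⟩
    have h3 := Real.logb_le_logb_of_le one_lt_two hpos hle
    have h4 : binaryWeight 1 = 1 := binaryWeight_two_pow 0
    -- The terms for `0` and `1` add up to `-16 + (1 - 8) < 0`, so no growth is needed here.
    rw [Finset.sum_range_succ, Finset.sum_range_succ, h4, binaryWeight_zero]
    norm_num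
    linarith
  | succ l h1 ih =>
    obtain ⟨p, hp⟩ := ih (by omega)
    have h := hx.rpow_mul_le_apply hsm (l := l + 1) (by omega) h2
    rw [← add_assoc, Nat.add_sub_cancel] at h
    rw [← add_assoc]
    have hq : 0 < (2 : ℝ) ^ ((binaryWeight (l + 1) : ℝ) - 16 * (1 / 2) ^ binaryWeight (l + 1)) *
      x (2 ^ s + l) := by positivity
    refine ⟨hq.trans_le h, ?_⟩
    have h3 := Real.logb_le_logb_of_le one_lt_two hq h
    rw [Real.logb_mul (by positivity) p.ne', Real.logb_rpow (by norm_num) (by norm_num)] at h3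
    rw [Finset.sum_range_succ]
    linarith

/-- The last entry of the solution of the triangular system is large. -/
theorem logb_apply_two_pow_sub_one (hx : IsTriangularSolution (2 ^ m) x) (s : ℕ) (hs : 1 ≤ s)
    (hsm : s ≤ m) : 0 < x (2 ^ s - 1) ∧
      s * 2 ^ s / 2 - 2 ^ s - 32 * (3 / 2 : ℝ) ^ s ≤ Real.logb 2 (x (2 ^ s - 1)) := by
  induction s, hs using Nat.le_induction with
  | base =>
    rw [show 2 ^ 1 - 1 = 1 by norm_num, hx.apply_one hsm]
    norm_num
  | succ s hs ih =>
    obtain ⟨p, hp⟩ := ih (by omega)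
    have h1 : 1 < 2 ^ s := Nat.one_lt_two_pow (by omega)
    obtain ⟨q, hq⟩ := hx.logb_apply_two_pow_add hs (by omega) p (2 ^ s - 1) (by omega) (by omega)
    have e : 2 ^ s + (2 ^ s - 1) = 2 ^ (s + 1) - 1 := by rw [pow_succ]; omega
    rw [e] at q hq
    refine ⟨q, ?_⟩
    -- The losses reproduce themselves: `(32 + 16) (3/2) ^ s = 32 (3/2) ^ (s + 1)`.
    rw [Nat.sub_add_cancel h1.le, Finset.sum_sub_distrib, ← Finset.mul_sum, sum_binaryWeight,
      sum_half_pow_binaryWeight] at hq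
    push_cast
    rw [pow_succ, pow_succ]
    linarith

end IsTriangularSolution

/-! ### The `±1`-matrix -/

/-- For `l ≥ 2`, with `σ` the sign of digit `s`, the value is `-σ` times the Walsh value at `l - 1`
if the flat is balanced, and `(σ - 1) c - σ c = -c` if the Walsh function is constantly `c` on it.
-/
theorem triangularRow_walsh_eq {m i : ℕ} (hi : i < 2 ^ m) (b : ℕ) :
    triangularRow i (fun j => walsh m j b) = 1 ∨ triangularRow i (fun j => walsh m j b) = -1 := by
  have hlt : ∀ {s l}, 2 ^ s + l < 2 ^ m → s < m := fun {s l} h =>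
    (Nat.pow_lt_pow_iff_right (a := 2) (by norm_num)).1 (by omega)
  rcases two_pow_cases i with rfl | ⟨s, rfl⟩ | ⟨s, hs, rfl⟩ | ⟨s, l, h1, h2, rfl⟩
  · rw [triangularRow_zero]; exact walsh_eq _ _ _
  · rw [triangularRow_two_pow]; exact walsh_eq _ _ _
  · have hs1 : 1 < 2 ^ s := Nat.one_lt_two_pow (by omega)
    have hsm := hlt hi
    have hev : Even (2 ^ s) := Nat.even_pow.2 ⟨even_two, by omega⟩
    have e1 := walsh_add_one_of_even (m := m) (by omega) hev b
    have e2 := walsh_add_one_of_even (m := m) (j := 2 ^ s - 2) (by omega)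
      ((Nat.even_sub (by omega)).2 (by simp [hev])) b
    rw [show 2 ^ s - 2 + 1 = 2 ^ s - 1 by omega] at e2
    rw [triangularRow_two_pow_add_one hs, e1, e2]
    rcases bitSign_eq 0 b with h | h <;> rcases walsh_eq m (2 ^ s) b with h3 | h3 <;>
      rcases walsh_eq m (2 ^ s - 2) b with h4 | h4 <;> rw [h, h3, h4] <;> norm_num
  · have hsm := hlt hi
    have hl1 : 1 ≤ l := by omega
    have hw : ∀ g ≤ l, walsh m (2 ^ s + g) b = bitSign s b * walsh m g b :=
      fun g hg => walsh_two_pow_add hsm (hg.trans_lt h2) b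
    have hsum : ∑ g ∈ initialFlat l, (walsh m (2 ^ s + g) b - walsh m g b) =
        (bitSign s b - 1) * ∑ g ∈ initialFlat l, walsh m g b := by
      rw [Finset.mul_sum]
      refine Finset.sum_congr rfl fun g hg => ?_
      rw [hw g (le_of_mem_initialFlat l hl1 g hg)]
      ring
    rw [triangularRow_two_pow_add h1 h2, hsum, Nat.add_sub_assoc hl1, hw _ (Nat.sub_le _ _)]
    rcases sum_walsh_initialFlat m b l hl1 (by omega) with h | h
    · rw [h]
      rcases bitSign_eq s b with h3 | h3 <;> rcases walsh_eq m (l - 1) b with h4 | h4 <;>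
        rw [h3, h4] <;> norm_num
    · rw [h _ (self_mem_initialFlat l hl1).2, Finset.sum_congr rfl h, Finset.sum_const,
        card_initialFlat l hl1, nsmul_eq_mul]
      have : (2 : ℝ) ^ binaryWeight l ≠ 0 := by positivity
      push_cast
      rcases bitSign_eq s b with h3 | h3 <;> rcases walsh_eq m l b with h4 | h4 <;>
        rw [h3, h4] <;> field_simp <;> norm_num

/-- The `±1`-matrix of Alon and Vũ of size `2 ^ m`. -/
noncomputable def alonVuMatrix (m : ℕ) : Matrix (Fin (2 ^ m)) (Fin (2 ^ m)) ℝ :=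
  Matrix.of fun i b => triangularRow i fun j => walsh m j b

theorem alonVuMatrix_eq {m : ℕ} (i b : Fin (2 ^ m)) :
    alonVuMatrix m i b = 1 ∨ alonVuMatrix m i b = -1 :=
  triangularRow_walsh_eq i.2 b

/-- The Walsh transform of a vector. -/
noncomputable def walshTransform {m : ℕ} (v : Fin (2 ^ m) → ℝ) (j : ℕ) : ℝ :=
  ∑ b, v b * walsh m j b

-- The factorization of the matrix into the triangular and the Walsh matrix.
open scoped Matrix in
theorem alonVuMatrix_mulVec {m : ℕ} (v : Fin (2 ^ m) → ℝ) (i : Fin (2 ^ m)) :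
    (alonVuMatrix m *ᵥ v) i = triangularRow i (walshTransform v) := by
  have : walshTransform v = ∑ b, v b • fun j => walsh m j b := by
    funext j
    simp [walshTransform]
  rw [this, map_sum]
  simp only [map_smul, Matrix.mulVec, dotProduct, alonVuMatrix, Matrix.of_apply, smul_eq_mul]
  exact Finset.sum_congr rfl fun b _ => mul_comm _ _

open scoped Matrix in
theorem eq_zero_of_walshTransform_eq_zero {m : ℕ} {v : Fin (2 ^ m) → ℝ}
    (h : ∀ j < 2 ^ m, walshTransform v j = 0) : v = 0 := by
  let Q : Matrix (Fin (2 ^ m)) (Fin (2 ^ m)) ℝ := Matrix.of fun j b => walsh m j b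
  have hQ : Q * Qᵀ = (2 ^ m : ℝ) • 1 := by
    ext i j
    simp only [Matrix.mul_apply, Q, Matrix.transpose_apply, Matrix.of_apply, Matrix.smul_apply,
      Matrix.one_apply, smul_eq_mul, mul_ite, mul_one, mul_zero]
    rw [Fin.sum_univ_eq_sum_range (fun b => walsh m i b * walsh m j b) (2 ^ m),
      sum_walsh_mul_walsh i.2 j.2]
    simp [Fin.ext_iff]
  have hdet : Q.det ≠ 0 := by
    intro h0
    have := congrArg Matrix.det hQ
    rw [Matrix.det_mul, h0, zero_mul, Matrix.det_smul, Matrix.det_one, mul_one] at this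
    exact (by positivity : (2 ^ m : ℝ) ^ Fintype.card (Fin (2 ^ m)) ≠ 0) this.symm
  refine Matrix.eq_zero_of_mulVec_eq_zero hdet ?_
  funext j
  rw [Pi.zero_apply, ← h j j.2]
  simp only [Matrix.mulVec, dotProduct, Q, Matrix.of_apply, walshTransform]
  exact Finset.sum_congr rfl fun b _ => mul_comm _ _

open scoped Matrix in
theorem eq_zero_of_alonVuMatrix_mulVec_eq_zero {m : ℕ} {v : Fin (2 ^ m) → ℝ}
    (h : alonVuMatrix m *ᵥ v = 0) : v = 0 := by
  refine eq_zero_of_walshTransform_eq_zero (eq_zero_of_triangularRow_eq_zero fun i hi => ?_)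
  rw [← alonVuMatrix_mulVec v ⟨i, hi⟩, h, Pi.zero_apply]

/-! ### From `±1`-matrices to `0/1`-matrices -/

/-- A `±1`-matrix of size `N` whose first row consists of ones, turned into a `0/1`-matrix
with first row and first column `(1, 0, …, 0)`. -/
noncomputable def zeroOneOfSign {N : ℕ} [NeZero N] (A : Matrix (Fin N) (Fin N) ℝ) :
    Matrix (Fin N) (Fin N) ℝ :=
  Matrix.of fun i j => if i = 0 ∧ j = 0 then 1 else (1 - A i 0 * A i j) / 2

section

variable {N : ℕ} [NeZero N] {A : Matrix (Fin N) (Fin N) ℝ}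

theorem isZeroOneMatrix_zeroOneOfSign (hA : ∀ i j, A i j = 1 ∨ A i j = -1) :
    IsZeroOneMatrix (zeroOneOfSign A) := by
  intro i j
  simp only [zeroOneOfSign, Matrix.of_apply]
  split_ifs
  · exact Or.inr rfl
  · rcases hA i 0 with h1 | h1 <;> rcases hA i j with h2 | h2 <;> rw [h1, h2] <;> norm_num

open scoped Matrix

theorem zeroOneOfSign_mulVec_zero (hA0 : ∀ j, A 0 j = 1) (v : Fin N → ℝ) :
    (zeroOneOfSign A *ᵥ v) 0 = v 0 := by
  simp only [Matrix.mulVec, dotProduct]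
  rw [Finset.sum_eq_single 0]
  · simp [zeroOneOfSign]
  · intro j _ hj
    simp [zeroOneOfSign, hj, hA0]
  · simp

/-- Outside row `0` the first column vanishes, so coordinate `0` of the vector may be replaced by
any `t`. -/
theorem zeroOneOfSign_mulVec (hA : ∀ i j, A i j = 1 ∨ A i j = -1) (v : Fin N → ℝ) (t : ℝ)
    {i : Fin N} (hi : i ≠ 0) :
    (zeroOneOfSign A *ᵥ v) i =
      (∑ j, Function.update v 0 t j - A i 0 * (A *ᵥ Function.update v 0 t) i) / 2 := by
  simp only [Matrix.mulVec, dotProduct]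
  rw [Finset.mul_sum, ← Finset.sum_sub_distrib, Finset.sum_div]
  refine Finset.sum_congr rfl fun j _ => ?_
  simp only [zeroOneOfSign, Matrix.of_apply, hi, false_and, if_false]
  rcases eq_or_ne j 0 with rfl | hj
  · rcases hA i 0 with h | h <;> rw [h] <;> norm_num
  · rw [Function.update_of_ne hj]
    ring

theorem sum_eq_mulVec_zero (hA0 : ∀ j, A 0 j = 1) (v : Fin N → ℝ) : ∑ j, v j = (A *ᵥ v) 0 := by
  simp [Matrix.mulVec, dotProduct, hA0]

theorem sum_update_zero (v : Fin N → ℝ) (t : ℝ) :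
    ∑ j, Function.update v 0 t j = t + ∑ j ∈ Finset.univ.erase 0, v j := by
  rw [← Finset.add_sum_erase _ _ (Finset.mem_univ (0 : Fin N)), Function.update_self]
  congr 1
  exact Finset.sum_congr rfl fun j hj => Function.update_of_ne (Finset.ne_of_mem_erase hj) _ _

theorem det_zeroOneOfSign_ne_zero (hA : ∀ i j, A i j = 1 ∨ A i j = -1) (hA0 : ∀ j, A 0 j = 1)
    (hinj : ∀ v, A *ᵥ v = 0 → v = 0) : (zeroOneOfSign A).det ≠ 0 := by
  intro h0
  obtain ⟨v, hv, hv0⟩ := Matrix.exists_mulVec_eq_zero_iff.2 h0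
  apply hv
  -- Chosen to make the coordinate sum zero, so that a kernel vector of the `0/1`-matrix becomes one
  -- of `A`.
  set t := -∑ j ∈ Finset.univ.erase 0, v j with ht
  have hsum : ∑ j, Function.update v 0 t j = 0 := by rw [sum_update_zero, ht]; ring
  have hz : Function.update v 0 t = 0 := by
    refine hinj _ (funext fun i => ?_)
    rcases eq_or_ne i 0 with rfl | hi
    · rw [← sum_eq_mulVec_zero hA0, hsum, Pi.zero_apply]
    · have h := zeroOneOfSign_mulVec hA v t hi
      rw [hv0, hsum, Pi.zero_apply] at h
      rw [Pi.zero_apply]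
      rcases hA i 0 with h1 | h1 <;> rw [h1] at h <;> linarith
  funext j
  rcases eq_or_ne j 0 with rfl | hj
  · rw [← zeroOneOfSign_mulVec_zero hA0 v, hv0]
  · rw [← congrFun hz j, Function.update_of_ne hj]

/-- Entries of a column of the inverse of a `±1`-matrix are bounded in terms of `chiMax`. -/
theorem two_mul_abs_le_chiMax (hA : ∀ i j, A i j = 1 ∨ A i j = -1) (hA0 : ∀ j, A 0 j = 1)
    (hinj : ∀ v, A *ᵥ v = 0 → v = 0) {z : Fin N → ℝ} {k : Fin N} (hk : k ≠ 0)
    (hz : A *ᵥ z = Pi.single k 1) {j : Fin N} (hj : j ≠ 0) : 2 * |z j| ≤ chiMax N := by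
  have hdet := det_zeroOneOfSign_ne_zero hA hA0 hinj
  set B := zeroOneOfSign A
  have hup : Function.update (Function.update z 0 0) 0 (z 0) = z := by simp
  -- Row `0` of `A` shows that the coordinates of `z` sum to zero, so only the `A *ᵥ z` term
  -- survives.
  have hB : B *ᵥ Function.update z 0 0 = (-(A k 0) / 2) • Pi.single k 1 := by
    funext i
    rcases eq_or_ne i 0 with rfl | hi
    · rw [zeroOneOfSign_mulVec_zero hA0]
      simp [hk.symm]
    · rw [zeroOneOfSign_mulVec hA _ (z 0) hi, hup, sum_eq_mulVec_zero hA0, hz]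
      rcases eq_or_ne i k with rfl | hik
      · simp [hk.symm]
      · simp [hk.symm, hik]
  have hinv : Function.update z 0 0 = (-(A k 0) / 2) • B⁻¹.col k := by
    rw [← Matrix.mulVec_single_one, ← Matrix.mulVec_smul, ← hB, Matrix.mulVec_mulVec,
      Matrix.nonsing_inv_mul _ (isUnit_iff_ne_zero.2 hdet), Matrix.one_mulVec]
  have hzj : z j = -(A k 0) / 2 * B⁻¹ j k := by
    have := congrFun hinv j
    rw [Function.update_of_ne hj] at this
    simpa using this
  have habs : |z j| = |B⁻¹ j k| / 2 := by
    rw [hzj, abs_mul, abs_div, abs_neg]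
    rcases hA k 0 with h | h <;> rw [h] <;> norm_num <;> ring
  rw [habs, mul_div_cancel₀ _ two_ne_zero]
  exact (isGreatest_chiMax N (NeZero.one_le)).2
    ⟨B, isZeroOneMatrix_zeroOneOfSign hA, hdet, j, k, rfl⟩

end

-- The Walsh transform of column `1` of the inverse solves the triangular system. Its values are
-- signed sums of the entries of that column: all but entry `0` are at most `χ/2` in absolute value,
-- and entry `0` is minus the sum of the others.
open scoped Matrix in
theorem exists_isTriangularSolution_le (m : ℕ) (hm : 1 ≤ m) :
    ∃ x, IsTriangularSolution (2 ^ m) x ∧ x (2 ^ m - 1) ≤ 2 ^ m * chiMax (2 ^ m) := by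
  have : NeZero (2 ^ m) := ⟨by positivity⟩
  have h1 : 1 < 2 ^ m := Nat.one_lt_two_pow (by omega)
  let A := alonVuMatrix m
  have hA : ∀ i j, A i j = 1 ∨ A i j = -1 := alonVuMatrix_eq
  have hA0 : ∀ j, A 0 j = 1 := fun j => by
    simp [A, alonVuMatrix, triangularRow_zero, walsh_zero_left]
  have hinj : ∀ v, A *ᵥ v = 0 → v = 0 := fun v => eq_zero_of_alonVuMatrix_mulVec_eq_zero
  have hdet : A.det ≠ 0 := fun h0 => by
    obtain ⟨v, hv, hv0⟩ := Matrix.exists_mulVec_eq_zero_iff.2 h0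
    exact hv (hinj v hv0)
  let k : Fin (2 ^ m) := ⟨1, h1⟩
  have hk : k ≠ 0 := by simp [k, Fin.ext_iff]
  let z : Fin (2 ^ m) → ℝ := A⁻¹ *ᵥ Pi.single k 1
  have hz : A *ᵥ z = Pi.single k 1 := by
    rw [Matrix.mulVec_mulVec, Matrix.mul_nonsing_inv _ (isUnit_iff_ne_zero.2 hdet),
      Matrix.one_mulVec]
  refine ⟨walshTransform z, fun i hi => ?_, ?_⟩
  · rw [← alonVuMatrix_mulVec z ⟨i, hi⟩, hz, Pi.single_apply]
    simp [k, Fin.ext_iff]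
  · have hbound : ∀ j ∈ Finset.univ.erase (0 : Fin (2 ^ m)), |z j| ≤ chiMax (2 ^ m) / 2 := by
      intro j hj
      have := two_mul_abs_le_chiMax hA hA0 hinj hk hz (Finset.ne_of_mem_erase hj)
      linarith
    have hcard := Finset.sum_le_card_nsmul _ _ _ hbound
    rw [Finset.card_erase_of_mem (Finset.mem_univ _), Finset.card_univ, Fintype.card_fin,
      nsmul_eq_mul, Nat.cast_sub h1.le] at hcard
    have hz0 : |z 0| ≤ ∑ j ∈ Finset.univ.erase 0, |z j| := by
      have hs := sum_eq_mulVec_zero hA0 z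
      rw [hz, Pi.single_eq_of_ne hk.symm, ← Finset.add_sum_erase _ _ (Finset.mem_univ 0)] at hs
      rw [eq_neg_of_add_eq_zero_left hs, abs_neg]
      exact Finset.abs_sum_le_sum_abs _ _
    have hχ := one_le_chiMax h1.le
    calc walshTransform z (2 ^ m - 1) ≤ ∑ j, |z j| := by
          refine Finset.sum_le_sum fun b _ => (le_abs_self _).trans (le_of_eq ?_)
          rw [abs_mul]
          rcases walsh_eq m (2 ^ m - 1) b with h | h <;> rw [h] <;> simp
      _ = |z 0| + ∑ j ∈ Finset.univ.erase 0, |z j| :=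
          (Finset.add_sum_erase _ _ (Finset.mem_univ 0)).symm
      _ ≤ 2 ^ m * chiMax (2 ^ m) := by
          push_cast at hcard
          nlinarith

theorem natCast_le_eight_mul_pow (m : ℕ) : (m : ℝ) ≤ 8 * (3 / 2) ^ m := by
  have := one_add_mul_le_pow (a := (1 / 2 : ℝ)) (by norm_num) m
  norm_num at this
  linarith [Nat.cast_nonneg (α := ℝ) m]

/-- The lower bound of Håstad and of Alon and Vũ for powers of two. -/
theorem logb_chiMax_two_pow_ge (m : ℕ) :
    m * 2 ^ m / 2 - 2 ^ m - 40 * (3 / 2 : ℝ) ^ m ≤ Real.logb 2 (chiMax (2 ^ m)) := by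
  have hχ := one_le_chiMax (n := 2 ^ m) Nat.one_le_two_pow
  rcases Nat.eq_zero_or_pos m with rfl | hm
  · have := Real.logb_nonneg one_lt_two hχ
    norm_num at this ⊢
    linarith
  obtain ⟨x, hx, hle⟩ := exists_isTriangularSolution_le m hm
  obtain ⟨hpos, hlog⟩ := hx.logb_apply_two_pow_sub_one m hm le_rfl
  have h := Real.logb_le_logb_of_le one_lt_two hpos hle
  rw [Real.logb_mul (by positivity) (by positivity), Real.logb_pow,
    Real.logb_self_eq_one one_lt_two, mul_one] at h
  -- The factor `2 ^ m` costs `m ≤ 8 (3/2) ^ m`, whence `40 = 32 + 8`.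
  have := natCast_le_eight_mul_pow m
  linarith

theorem mainTheorem5 :
    ∃ ε : ℕ → ℝ, Tendsto ε atTop (𝓝 0) ∧
      ∀ d : ℕ, 1 ≤ d →
        (2 : ℝ) ^ (d - 1) / Real.sqrt d ^ (d + 1) ≤ 1 / (Real.sqrt d * rhoMax (d - 1)) ∧
        1 / (Real.sqrt d * rhoMax (d - 1)) ≤ flatMin d ∧
        flatMin d ≤ 1 / chiMax d ∧
        1 / chiMax d ≤ (1 / (d : ℝ)) ^ ((d : ℝ) / 2) * (2 : ℝ) ^ ((d : ℝ) * (2 + ε d)) :=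
  ⟨_, tendsto_const_mul_pow_log 120, fun d hd => ⟨rhoMax_bound_le d hd, le_flatMin d hd,
    flatMin_le d hd, one_div_chiMax_le logb_chiMax_two_pow_ge d hd⟩⟩
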